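/- Fix $\alpha>3$. Let $K^c=\{(x_1,x_2)\in\mathbb Z^2: x_1x_2=0\}$, $K=\mathbb Z^2\setminus K^c$, and let $(X_n)_{n\ge 0}$ be the nearest-neighbour Markov chain on $\mathbb Z^2$ with the following transition probabilities. From every point of $K$ and from $(0,0)$ each of the four neighbours is chosen with probability $1/4$. From a point $x\in K^c$ with $|x_1|+|x_2|=i>0$ the step towards the origin along the axis has probability $1-\frac{3}{4i^{\alpha}}$, and each of the three other neighbours has probability $\frac1{4i^{\alpha}}$. Write $\mathbb P_x,\mathbb E_x$ for the law and the expectation when $X_0=x$, and $\mathbb P=\mathbb P_{(1,1)}$. Put $\rho_0=0$ and, for $i\ge1$, $\eta_i=\inf\{k>\rho_{i-1}: X_k\in K^c\}$ and $\rho_i=\inf\{k>\eta_i: X_k\in K\}$; put $\rho=\inf\{k>0: X_k\in K\}$. For $A\subset\mathbb Z^2$ let $\mathscr L(A,n)=\sum_{i=1}^n \mathbf 1_{X_i\in A}$. Then $\mathbb P$-almost surely all $\rho_m$ are finite. The Markov chain $(X_{\eta_i})_{i\ge1}$ on $K^c$ (whose transition probability from $y$ to $x$ is $\mathbb P_y(X_{\eta'}=x)$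 with $\eta'=\inf\{k>\rho: X_k\in K^c\}$) has a unique invariant probability measure $\pi^*$. The sums $\sum_{x\in K^c}\pi^*(x)\mathbb E_x[\rho]$ and $\sum_{x\in K^c}\pi^*(x)\mathbb E_x[\mathscr L(\{(0,0)\},\rho)]$ are finite, and, as $m\to\infty$, in $\mathbb P$-probability, $$\frac1m\,\mathscr L(K^c,\rho_m)\to\sum_{x\in K^c}\pi^*(x)\,\mathbb E_x[\rho],\qquad \frac1m\,\mathscr L(\{(0,0)\},\rho_m)\to\sum_{x\in K^c}\pi^*(x)\,\mathbb E_x[\mathscr L(\{(0,0)\},\rho)].$$ -/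

import Mathlib

open MeasureTheory ProbabilityTheory Filter Topology
open scoped ENNReal NNReal

noncomputable section

namespace AxisWalk

/-- The axis `K^c = {(x, y) ∈ ℤ² : x y = 0}`. -/
def axis : Set (ℤ × ℤ) := {x | x.1 * x.2 = 0}

/-- The four open cones `K`, the complement of the axis. -/
def cone : Set (ℤ × ℤ) := {x | x.1 * x.2 ≠ 0}

/-- The maximum norm on `ℤ²`. -/
def maxNorm (x : ℤ × ℤ) : ℤ := max |x.1| |x.2|

/-- The nearest neighbours of a point of `ℤ²`. -/
def neighbors (x : ℤ × ℤ) : Finset (ℤ × ℤ) :=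
  {(x.1 + 1, x.2), (x.1 - 1, x.2), (x.1, x.2 + 1), (x.1, x.2 - 1)}

/-- The transition probabilities of the walk: simple random walk on the cones and at the origin.
At a point of the axis at distance `i > 0` from the origin, the step towards the origin (the only
one that decreases the maximum norm) has probability `1 - 3 / (4 i ^ α)` and each of the three
other steps has probability `1 / (4 i ^ α)`. -/
def transProb (α : ℝ≥0) (x y : ℤ × ℤ) : ℝ :=
  if y ∈ neighbors x then
    if x.1 * x.2 ≠ 0 ∨ x = (0, 0) then 1 / 4
    else if maxNorm y < maxNorm x then 1 - 3 / (4 * (maxNorm x : ℝ) ^ (α : ℝ))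
    else 1 / (4 * (maxNorm x : ℝ) ^ (α : ℝ))
  else 0

theorem maxNorm_pos_of_ne {x : ℤ × ℤ} (h : x ≠ (0, 0)) : 1 ≤ maxNorm x := by
  by_contra hlt
  apply h
  have h1 : |x.1| ≤ maxNorm x := le_max_left _ _
  have h2 : |x.2| ≤ maxNorm x := le_max_right _ _
  have h3 : x.1 = 0 := abs_eq_zero.1 (le_antisymm (by omega) (abs_nonneg _))
  have h4 : x.2 = 0 := abs_eq_zero.1 (le_antisymm (by omega) (abs_nonneg _))
  exact Prod.ext h3 h4

theorem transProb_nonneg (α : ℝ≥0) (x y : ℤ × ℤ) : 0 ≤ transProb α x y := by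
  unfold transProb
  split_ifs with h1 h2 h3
  · norm_num
  · have hx : x ≠ (0, 0) := fun h => h2 (Or.inr h)
    have h4 : (1 : ℝ) ≤ (maxNorm x : ℝ) := by exact_mod_cast maxNorm_pos_of_ne hx
    have h5 : (1 : ℝ) ≤ (maxNorm x : ℝ) ^ (α : ℝ) := Real.one_le_rpow h4 α.2
    rw [sub_nonneg, div_le_one (by positivity)]
    linarith
  · have hx : x ≠ (0, 0) := fun h => h2 (Or.inr h)
    have h4 : (1 : ℝ) ≤ (maxNorm x : ℝ) := by exact_mod_cast maxNorm_pos_of_ne hx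
    positivity
  · exact le_rfl

theorem sum_neighbors (x : ℤ × ℤ) (f : ℤ × ℤ → ℝ) :
    ∑ y ∈ neighbors x, f y =
      f (x.1 + 1, x.2) + (f (x.1 - 1, x.2) + (f (x.1, x.2 + 1) + f (x.1, x.2 - 1))) := by
  unfold neighbors
  rw [Finset.sum_insert, Finset.sum_insert, Finset.sum_insert, Finset.sum_singleton]
  all_goals
    simp only [Finset.mem_insert, Finset.mem_singleton, Prod.mk.injEq, not_or, not_and]
    omega

theorem sum_transProb (α : ℝ≥0) (x : ℤ × ℤ) : ∑ y ∈ neighbors x, transProb α x y = 1 := by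
  by_cases h : x.1 * x.2 ≠ 0 ∨ x = (0, 0)
  · have : ∀ y ∈ neighbors x, transProb α x y = 1 / 4 := by
      intro y hy
      simp only [transProb, hy, if_true, if_pos h]
    rw [Finset.sum_congr rfl this, sum_neighbors]
    norm_num
  · have key : ∀ y ∈ neighbors x, transProb α x y =
        if maxNorm y < maxNorm x then 1 - 3 / (4 * (maxNorm x : ℝ) ^ (α : ℝ))
        else 1 / (4 * (maxNorm x : ℝ) ^ (α : ℝ)) := by
      intro y hy
      simp only [transProb, hy, if_true, if_neg h]
    rw [Finset.sum_congr rfl key, sum_neighbors]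
    generalize (4 * (maxNorm x : ℝ) ^ (α : ℝ)) = c
    obtain ⟨a, b⟩ := x
    push Not at h
    obtain ⟨h0, hne⟩ := h
    clear key
    rcases mul_eq_zero.1 h0 with h1 | h1
    · simp only at h1
      subst h1
      have hb : b ≠ 0 := fun hb => hne (by rw [hb])
      rcases lt_or_gt_of_ne hb with hb | hb
      · rw [if_neg (by simp only [maxNorm, Int.abs_eq_natAbs]; omega),
          if_neg (by simp only [maxNorm, Int.abs_eq_natAbs]; omega),
          if_pos (by simp only [maxNorm, Int.abs_eq_natAbs]; omega),
          if_neg (by simp only [maxNorm, Int.abs_eq_natAbs]; omega)]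
        ring
      · rw [if_neg (by simp only [maxNorm, Int.abs_eq_natAbs]; omega),
          if_neg (by simp only [maxNorm, Int.abs_eq_natAbs]; omega),
          if_neg (by simp only [maxNorm, Int.abs_eq_natAbs]; omega),
          if_pos (by simp only [maxNorm, Int.abs_eq_natAbs]; omega)]
        ring
    · simp only at h1
      subst h1
      have ha : a ≠ 0 := fun ha => hne (by rw [ha])
      rcases lt_or_gt_of_ne ha with ha | ha
      · rw [if_pos (by simp only [maxNorm, Int.abs_eq_natAbs]; omega),
          if_neg (by simp only [maxNorm, Int.abs_eq_natAbs]; omega),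
          if_neg (by simp only [maxNorm, Int.abs_eq_natAbs]; omega),
          if_neg (by simp only [maxNorm, Int.abs_eq_natAbs]; omega)]
        ring
      · rw [if_neg (by simp only [maxNorm, Int.abs_eq_natAbs]; omega),
          if_pos (by simp only [maxNorm, Int.abs_eq_natAbs]; omega),
          if_neg (by simp only [maxNorm, Int.abs_eq_natAbs]; omega),
          if_neg (by simp only [maxNorm, Int.abs_eq_natAbs]; omega)]
        ring

/-- The law of one step of the walk from `x`. -/
def stepPMF (α : ℝ≥0) (x : ℤ × ℤ) : PMF (ℤ × ℤ) :=
  PMF.ofFinset (fun y => ENNReal.ofReal (transProb α x y)) (neighbors x)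
    (by
      rw [← ENNReal.ofReal_sum_of_nonneg (fun y _ => transProb_nonneg α x y), sum_transProb,
        ENNReal.ofReal_one])
    (by
      intro y hy
      simp only [transProb, hy, if_false, ENNReal.ofReal_zero])

/-- The transition kernel of the walk. -/
def stepKernel (α : ℝ≥0) : Kernel (ℤ × ℤ) (ℤ × ℤ) :=
  Kernel.ofFunOfCountable (fun x => (stepPMF α x).toMeasure)

instance (α : ℝ≥0) : IsMarkovKernel (stepKernel α) :=
  ⟨fun x => inferInstanceAs (IsProbabilityMeasure (stepPMF α x).toMeasure)⟩

/-- The law of the next position given the trajectory up to time `n`: it depends on the current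
position only. -/
def historyKernel (α : ℝ≥0) (n : ℕ) : Kernel ((_ : Finset.Iic n) → ℤ × ℤ) (ℤ × ℤ) :=
  (stepKernel α).comap (fun h => h ⟨n, Finset.mem_Iic.2 le_rfl⟩) (measurable_pi_apply _)

instance (α : ℝ≥0) (n : ℕ) : IsMarkovKernel (historyKernel α n) :=
  Kernel.IsMarkovKernel.comap _ _

/-- `ℙ_x`: the law, on the space of trajectories, of the walk started at `x`. The walk itself is
the coordinate process `X_n ω = ω n`. -/
def walkLaw (α : ℝ≥0) (x : ℤ × ℤ) : Measure (ℕ → ℤ × ℤ) :=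
  Kernel.traj (X := fun _ => ℤ × ℤ) (historyKernel α) 0 (fun _ => x)

/-- The first time after `T` at which the trajectory is in `A` (`⊤` if there is none). -/
def hitAfter (A : Set (ℤ × ℤ)) (T : ℕ∞) (ω : ℕ → ℤ × ℤ) : ℕ∞ :=
  sInf ((fun k : ℕ => (k : ℕ∞)) '' {k | T < (k : ℕ∞) ∧ ω k ∈ A})

/-- The entrance times in the cones: `ρ_0 = 0`, and `ρ_{i+1} = inf {k > η_{i+1} : X_k ∈ K}` where
`η_{i+1} = inf {k > ρ_i : X_k ∈ K^c}`. -/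
def rhoTime : ℕ → (ℕ → ℤ × ℤ) → ℕ∞
  | 0, _ => 0
  | i + 1, ω => hitAfter cone (hitAfter axis (rhoTime i ω) ω) ω

/-- `ρ = inf {k > 0 : X_k ∈ K}`. -/
def rho (ω : ℕ → ℤ × ℤ) : ℕ∞ := hitAfter cone 0 ω

/-- The local time in `A` until time `T`: the number of `i` with `1 ≤ i ≤ T` and `X_i ∈ A`. -/
def localTime (A : Set (ℤ × ℤ)) (T : ℕ∞) (ω : ℕ → ℤ × ℤ) : ℕ∞ :=
  {i : ℕ | 1 ≤ i ∧ (i : ℕ∞) ≤ T ∧ ω i ∈ A}.encard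

/-- The transition probabilities of the Markov chain `(X_{η_i})` on the axis, `η_i` being the
`i`-th entrance time in the axis: the walk starts from `y` on the axis, leaves the axis
at time `ρ`, and `x` is the point where it comes back to the axis for the first time after `ρ`. -/
def returnProb (α : ℝ≥0) (y x : axis) : ℝ≥0∞ :=
  walkLaw α y {ω | ∃ n : ℕ, hitAfter axis (rho ω) ω = n ∧ ω n = x}

/-- `π` is an invariant probability measure of the chain `(X_{η_i})`. -/
def IsInvariant (α : ℝ≥0) (π : PMF axis) : Prop :=
  ∀ x, ∑' y, π y * returnProb α y x = π x

/-- `𝔼_x[ρ]`. -/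
def meanRho (α : ℝ≥0) (x : ℤ × ℤ) : ℝ≥0∞ :=
  ∫⁻ ω, (rho ω : ℝ≥0∞) ∂(walkLaw α x)

/-- `𝔼_x[ℒ(0, ρ)]`. -/
def meanLocalTimeZero (α : ℝ≥0) (x : ℤ × ℤ) : ℝ≥0∞ :=
  ∫⁻ ω, (localTime {(0, 0)} (rho ω) ω : ℝ≥0∞) ∂(walkLaw α x)

end AxisWalk

end

namespace AxisWalk

/-! Cut the walk into cycles, each running from an entrance in the axis to the next entrance that
follows a visit of the cones. The entrance points form a Markov chain satisfying Doeblin's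
condition: from every point of the axis it moves to `(1, 0)` with probability at least `1/512`
(`le_returnProb`). Indeed, from distance `i` the walk runs straight to the origin with probability
`∏_{j ≤ i} (1 - 3 / (4 j ^ α))`, which is bounded away from zero, and from the origin it can follow
`(1, 0)`, `(1, 1)`, `(1, 0)`. Doeblin's condition gives the invariant law as a geometric series, its
uniqueness, and a geometric contraction of oscillations (`doeblinLaw_invariant`, `eq_doeblinLaw`,
`exists_oscillation_le`).

Finiteness comes from Lyapunov functions through `lintegral_le_of_superharmonic`. The mean sojourn
on the axis grows at most linearly with the starting distance. The point where the axis is left has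
mean `ℓ¹` norm at most `5`, uniformly in the start, and the `ℓ¹` norm is harmonic in the cones, so
the next entrance point has mean norm at most `5` as well. The invariant law therefore has a first
moment, and the stationary mean of `ρ` is finite. That the cones are left almost surely follows from
a maximum principle.

Up to time `ρ_m` both local times are exactly sums of a functional over the first `m` cycles
(`IsRegular.exists_rhoTime_eq`): an excursion in the cones meets the axis only at its endpoint, and
that endpoint is never the origin. For the stationary walk such sums obey a weak law
(`tendsto_mixedLaw_gap`): the functional is truncated, the bounded part has variance `O(n)` by the
contraction of oscillations, and the remainder is controlled in mean by stationarity. Finally, the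
walk from `(1, 1)` seen from its first entrance in the axis has a law dominated by a multiple of the
stationary one (`exists_walkLaw_entryShift_le`), so convergence in probability carries over. -/

/-! ### Law of the walk on trajectories and the Markov property -/

/-- The one-step transition probabilities, as extended nonnegative reals. -/
noncomputable def stepProb (α : ℝ≥0) (x y : ℤ × ℤ) : ℝ≥0∞ := ENNReal.ofReal (transProb α x y)

/-- The trajectory that starts at `x` and then follows `ω`. -/
def consPath (x : ℤ × ℤ) (ω : ℕ → ℤ × ℤ) : ℕ → ℤ × ℤ
  | 0 => x
  | n + 1 => ω n

/-- The trajectory seen from time `n` on. -/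
def shiftPath (n : ℕ) (ω : ℕ → ℤ × ℤ) : ℕ → ℤ × ℤ := fun k => ω (n + k)

@[simp] theorem consPath_zero (x : ℤ × ℤ) (ω : ℕ → ℤ × ℤ) : consPath x ω 0 = x := rfl

@[simp] theorem consPath_succ (x : ℤ × ℤ) (ω : ℕ → ℤ × ℤ) (n : ℕ) :
    consPath x ω (n + 1) = ω n := rfl

@[simp] theorem shiftPath_apply (n k : ℕ) (ω : ℕ → ℤ × ℤ) : shiftPath n ω k = ω (n + k) := rfl

@[simp] theorem shiftPath_zero (ω : ℕ → ℤ × ℤ) : shiftPath 0 ω = ω := by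
  ext1 k; simp

theorem shiftPath_shiftPath (m n : ℕ) (ω : ℕ → ℤ × ℤ) :
    shiftPath m (shiftPath n ω) = shiftPath (n + m) ω := by
  ext1 k; simp [add_assoc]

theorem shiftPath_succ_consPath (n : ℕ) (x : ℤ × ℤ) (ω : ℕ → ℤ × ℤ) :
    shiftPath (n + 1) (consPath x ω) = shiftPath n ω := by
  ext1 k
  simp only [shiftPath_apply]
  rw [show n + 1 + k = (n + k) + 1 by ring, consPath_succ]

theorem measurable_consPath (x : ℤ × ℤ) : Measurable (consPath x) := by
  refine measurable_pi_lambda _ fun n => ?_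
  cases n with
  | zero => exact measurable_const
  | succ n => exact measurable_pi_apply n

theorem measurable_shiftPath (n : ℕ) : Measurable (shiftPath n) :=
  measurable_pi_lambda _ fun _ => measurable_pi_apply _

instance (α : ℝ≥0) (x : ℤ × ℤ) : IsProbabilityMeasure (walkLaw α x) := by
  unfold walkLaw; infer_instance

theorem stepProb_eq_zero {α : ℝ≥0} {x y : ℤ × ℤ} (h : y ∉ neighbors x) : stepProb α x y = 0 := by
  simp [stepProb, transProb, h]

theorem sum_stepProb (α : ℝ≥0) (x : ℤ × ℤ) : ∑ y ∈ neighbors x, stepProb α x y = 1 := by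
  unfold stepProb
  rw [← ENNReal.ofReal_sum_of_nonneg (fun y _ => transProb_nonneg α x y), sum_transProb,
    ENNReal.ofReal_one]

theorem stepKernel_singleton (α : ℝ≥0) (x y : ℤ × ℤ) : stepKernel α x {y} = stepProb α x y := by
  change (stepPMF α x).toMeasure {y} = _
  rw [PMF.toMeasure_apply_singleton _ _ (measurableSet_singleton y)]
  rfl

/-- The trajectories that agree with `a` until time `n`. -/
def cylinderSet (n : ℕ) (a : ℕ → ℤ × ℤ) : Set (ℕ → ℤ × ℤ) := {ω | ∀ i ≤ n, ω i = a i}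

theorem measurableSet_cylinderSet (n : ℕ) (a : ℕ → ℤ × ℤ) : MeasurableSet (cylinderSet n a) := by
  have : cylinderSet n a = ⋂ i : ℕ, ⋂ _ : i ≤ n, (fun ω : ℕ → ℤ × ℤ => ω i) ⁻¹' {a i} := by
    ext ω; simp [cylinderSet]
  rw [this]
  exact MeasurableSet.iInter fun i => MeasurableSet.iInter fun _ =>
    measurable_pi_apply i (measurableSet_singleton _)

theorem walkLaw_cylinderSet_zero (α : ℝ≥0) (x : ℤ × ℤ) (a : ℕ → ℤ × ℤ) :
    walkLaw α x (cylinderSet 0 a) = if a 0 = x then 1 else 0 := by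
  have h := Kernel.traj_map_frestrictLe_apply (κ := historyKernel α) (X := fun _ => ℤ × ℤ) 0 0
    (fun _ => x)
  rw [Kernel.partialTraj_self, Kernel.id_apply] at h
  have h2 : cylinderSet 0 a = (Preorder.frestrictLe (π := fun _ => ℤ × ℤ) 0) ⁻¹'
      {b | b ⟨0, Finset.mem_Iic.2 le_rfl⟩ = a 0} := by
    ext ω; simp [cylinderSet]
  have hm : MeasurableSet {b : (i : Finset.Iic 0) → ℤ × ℤ | b ⟨0, Finset.mem_Iic.2 le_rfl⟩ = a 0} :=
    measurable_pi_apply (⟨0, Finset.mem_Iic.2 le_rfl⟩ : Finset.Iic 0) (measurableSet_singleton _)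
  rw [h2, walkLaw, ← Measure.map_apply (by fun_prop) hm, h, Measure.dirac_apply' _ hm]
  simp [Set.indicator, eq_comm]

/-- A cylinder of length `n + 1` is a rectangle for the pair (history up to `n`, next position),
whose law is a composition product; on the history factor the kernel is constant. -/
theorem walkLaw_cylinderSet_succ (α : ℝ≥0) (x : ℤ × ℤ) (a : ℕ → ℤ × ℤ) (n : ℕ) :
    walkLaw α x (cylinderSet (n + 1) a) =
      walkLaw α x (cylinderSet n a) * stepProb α (a n) (a (n + 1)) := by
  have h := Kernel.partialTraj_compProd_eq_map_traj (κ := historyKernel α)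
    (X := fun _ => ℤ × ℤ) (Nat.zero_le n) (x₀ := fun _ => x)
  have h2 : cylinderSet (n + 1) a = (fun ω : ℕ → ℤ × ℤ =>
      (Preorder.frestrictLe (π := fun _ => ℤ × ℤ) n ω, ω (n + 1))) ⁻¹'
      ({b | ∀ i : Finset.Iic n, b i = a i} ×ˢ {a (n + 1)}) := by
    ext ω
    simp only [cylinderSet, Set.mem_ofPred_eq, Set.mem_preimage, Set.mem_prod, Set.mem_singleton_iff,
      Preorder.frestrictLe_apply, Subtype.forall, Finset.mem_Iic]
    constructor
    · intro h
      exact ⟨fun i hi => h i (by omega), h _ le_rfl⟩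
    · rintro ⟨h1, h3⟩ i hi
      rcases Nat.lt_or_ge n i with hlt | hle
      · obtain rfl : i = n + 1 := by omega
        exact h3
      · exact h1 i hle
  have h3 : cylinderSet n a = (Preorder.frestrictLe (π := fun _ => ℤ × ℤ) n) ⁻¹'
      {b | ∀ i : Finset.Iic n, b i = a i} := by
    ext ω; simp [cylinderSet]
  have hm : MeasurableSet {b : (i : Finset.Iic n) → ℤ × ℤ | ∀ i : Finset.Iic n, b i = a i} :=
    (Set.countable_univ.mono (Set.subset_univ _)).measurableSet
  rw [h2, walkLaw, ← Measure.map_apply (by fun_prop) (hm.prod (measurableSet_singleton _)), ← h,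
    Measure.compProd_apply_prod hm (measurableSet_singleton _), h3,
    ← Measure.map_apply (by fun_prop) hm, Kernel.traj_map_frestrictLe_apply]
  rw [setLIntegral_congr_fun (g := fun _ => stepProb α (a n) (a (n + 1))) hm, setLIntegral_const,
    mul_comm]
  intro b hb
  change stepKernel α (b ⟨n, _⟩) _ = _
  rw [hb, stepKernel_singleton]

theorem walkLaw_cylinderSet (α : ℝ≥0) (x : ℤ × ℤ) (a : ℕ → ℤ × ℤ) (n : ℕ) :
    walkLaw α x (cylinderSet n a) =
      (if a 0 = x then 1 else 0) * ∏ i ∈ Finset.range n, stepProb α (a i) (a (i + 1)) := by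
  induction n with
  | zero => simp [walkLaw_cylinderSet_zero]
  | succ n ih => rw [walkLaw_cylinderSet_succ, ih, Finset.prod_range_succ, mul_assoc]

/-- Histories of length `n` form a countable set, so cylinder masses determine the marginals, and a
projective limit is unique. -/
theorem measure_eq_of_cylinderSet {μ ν : Measure (ℕ → ℤ × ℤ)} [IsFiniteMeasure μ]
    [IsFiniteMeasure ν] (h : ∀ n a, μ (cylinderSet n a) = ν (cylinderSet n a)) : μ = ν := by
  have key : ∀ n : ℕ, μ.map (Preorder.frestrictLe (π := fun _ => ℤ × ℤ) n) =
      ν.map (Preorder.frestrictLe (π := fun _ => ℤ × ℤ) n) := by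
    intro n
    rw [Measure.ext_iff_singleton]
    intro b
    rw [Measure.map_apply (by fun_prop) (measurableSet_singleton _),
      Measure.map_apply (by fun_prop) (measurableSet_singleton _)]
    have : (Preorder.frestrictLe (π := fun _ => ℤ × ℤ) n) ⁻¹' {b} =
        cylinderSet n (fun i => if hi : i ≤ n then b ⟨i, Finset.mem_Iic.2 hi⟩ else 0) := by
      ext ω
      simp only [Set.mem_preimage, Set.mem_singleton_iff, cylinderSet, Set.mem_ofPred_eq, funext_iff,
        Preorder.frestrictLe_apply, Subtype.forall, Finset.mem_Iic]
      refine forall_congr' fun i => ?_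
      refine forall_congr' fun hi => ?_
      rw [dif_pos hi]
    rw [this, h]
  have hproj : IsProjectiveMeasureFamily (fun I : Finset ℕ => ν.map I.restrict) := by
    intro I J hJI
    dsimp only
    rw [Measure.map_map (by fun_prop) (by fun_prop)]
    rfl
  have hν : IsProjectiveLimit ν (fun I : Finset ℕ => ν.map I.restrict) := fun I => rfl
  have hμ : IsProjectiveLimit μ (fun I : Finset ℕ => ν.map I.restrict) :=
    (isProjectiveLimit_nat_iff hproj μ).2 key
  exact hμ.unique hν

/-- First-step decomposition, checked on cylinders by splitting off the first factor of the product.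
All later recursions in the starting point rest on it. -/
theorem walkLaw_eq_sum (α : ℝ≥0) (x : ℤ × ℤ) :
    walkLaw α x = ∑ y ∈ neighbors x, stepProb α x y • (walkLaw α y).map (consPath x) := by
  have hap : ∀ s, MeasurableSet s →
      (∑ y ∈ neighbors x, stepProb α x y • (walkLaw α y).map (consPath x)) s =
      ∑ y ∈ neighbors x, stepProb α x y * walkLaw α y (consPath x ⁻¹' s) := by
    intro s hs
    simp [Measure.finsetSum_apply, Measure.map_apply (measurable_consPath x) hs]
  have : IsFiniteMeasure (∑ y ∈ neighbors x, stepProb α x y • (walkLaw α y).map (consPath x)) := by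
    constructor
    rw [hap _ MeasurableSet.univ]
    simp [sum_stepProb]
  refine measure_eq_of_cylinderSet fun n a => ?_
  rw [hap _ (measurableSet_cylinderSet n a)]
  by_cases hx : a 0 = x
  · cases n with
    | zero =>
      have : consPath x ⁻¹' cylinderSet 0 a = Set.univ := by
        ext ω; simp [cylinderSet, hx]
      simp [walkLaw_cylinderSet, hx, this, sum_stepProb]
    | succ n =>
      have : consPath x ⁻¹' cylinderSet (n + 1) a = cylinderSet n (fun i => a (i + 1)) := by
        ext ω
        simp only [cylinderSet, Set.mem_preimage, Set.mem_ofPred_eq]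
        constructor
        · intro h i hi
          exact h (i + 1) (by omega)
        · intro h i hi
          cases i with
          | zero => exact hx.symm
          | succ i => exact h i (by omega)
      rw [this]
      simp only [walkLaw_cylinderSet]
      rw [Finset.prod_range_succ', hx]
      by_cases hn : a 1 ∈ neighbors x
      · rw [Finset.sum_eq_single_of_mem (a 1) hn]
        · simp [mul_comm]
        · intro y _ hy
          simp [Ne.symm hy]
      · rw [Finset.sum_eq_zero]
        · simp [stepProb_eq_zero hn]
        · intro y hy
          have : a 1 ≠ y := fun h => hn (h ▸ hy)
          simp [this]
  · have : consPath x ⁻¹' cylinderSet n a = ∅ := by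
      ext ω
      simp only [cylinderSet, Set.mem_preimage, Set.mem_ofPred_eq, Set.mem_empty_iff_false, iff_false]
      intro h
      exact hx (h 0 (Nat.zero_le _)).symm
    simp [walkLaw_cylinderSet, hx, this]

theorem lintegral_walkLaw_step (α : ℝ≥0) (x : ℤ × ℤ) {F : (ℕ → ℤ × ℤ) → ℝ≥0∞}
    (hF : Measurable F) :
    ∫⁻ ω, F ω ∂(walkLaw α x) =
      ∑ y ∈ neighbors x, stepProb α x y * ∫⁻ ω, F (consPath x ω) ∂(walkLaw α y) := by
  conv_lhs => rw [walkLaw_eq_sum]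
  rw [lintegral_finsetSum_measure]
  refine Finset.sum_congr rfl fun y _ => ?_
  rw [lintegral_smul_measure, lintegral_map hF (measurable_consPath x), smul_eq_mul]

theorem measurable_lintegral_walkLaw (α : ℝ≥0) (H : (ℕ → ℤ × ℤ) → ℝ≥0∞) (n : ℕ) :
    Measurable fun ω : ℕ → ℤ × ℤ => ∫⁻ ω', H ω' ∂(walkLaw α (ω n)) :=
  (Measurable.of_discrete (f := fun x => ∫⁻ ω', H ω' ∂(walkLaw α x))).comp (measurable_pi_apply n)

theorem ae_start (α : ℝ≥0) (x : ℤ × ℤ) : ∀ᵐ ω ∂(walkLaw α x), ω 0 = x := by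
  have h : walkLaw α x (cylinderSet 0 fun _ => x) = 1 := by
    rw [walkLaw_cylinderSet_zero]; simp
  have h2 := (mem_ae_iff_prob_eq_one (measurableSet_cylinderSet 0 fun _ => x)).2 h
  filter_upwards [h2] with ω hω
  exact hω 0 le_rfl

/-- Peeling off the first step turns the statement at `n + 1` into the statement at `n` for `G ∘
consPath x`, which depends on one coordinate less; hence `G` and the starting point vary in the
induction. -/
theorem lintegral_markov (α : ℝ≥0) (n : ℕ) (x : ℤ × ℤ) {G H : (ℕ → ℤ × ℤ) → ℝ≥0∞}
    (hG : Measurable G) (hH : Measurable H)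
    (hdep : ∀ ω ω' : ℕ → ℤ × ℤ, (∀ i ≤ n, ω i = ω' i) → G ω = G ω') :
    ∫⁻ ω, G ω * H (shiftPath n ω) ∂(walkLaw α x) =
      ∫⁻ ω, G ω * ∫⁻ ω', H ω' ∂(walkLaw α (ω n)) ∂(walkLaw α x) := by
  induction n generalizing x G with
  | zero =>
    have h1 : ∀ᵐ ω ∂(walkLaw α x), G ω * H (shiftPath 0 ω) = G (fun _ => x) * H ω := by
      filter_upwards [ae_start α x] with ω hω
      rw [shiftPath_zero, hdep ω (fun _ => x)]
      intro i hi
      rw [Nat.le_zero.1 hi, hω]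
    have h2 : ∀ᵐ ω ∂(walkLaw α x), G ω * ∫⁻ ω', H ω' ∂(walkLaw α (ω 0)) =
        G (fun _ => x) * ∫⁻ ω', H ω' ∂(walkLaw α x) := by
      filter_upwards [ae_start α x] with ω hω
      rw [hω, hdep ω (fun _ => x)]
      intro i hi
      rw [Nat.le_zero.1 hi, hω]
    rw [lintegral_congr_ae h1, lintegral_congr_ae h2, lintegral_const_mul _ hH, lintegral_const]
    simp
  | succ n ih =>
    have hm1 : Measurable fun ω => G ω * H (shiftPath (n + 1) ω) :=
      hG.mul (hH.comp (measurable_shiftPath _))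
    have hm2 : Measurable fun ω : ℕ → ℤ × ℤ =>
        G ω * ∫⁻ ω', H ω' ∂(walkLaw α (ω (n + 1))) :=
      hG.mul (measurable_lintegral_walkLaw α H _)
    rw [lintegral_walkLaw_step α x hm1, lintegral_walkLaw_step α x hm2]
    refine Finset.sum_congr rfl fun y _ => ?_
    congr 1
    simp only [shiftPath_succ_consPath, consPath_succ]
    refine ih y (hG.comp (measurable_consPath x)) fun ω ω' h => hdep _ _ fun i hi => ?_
    cases i with
    | zero => rfl
    | succ i => exact h i (by omega)

/-! ### Hitting times and local times of a trajectory -/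

theorem mem_cone_iff {x : ℤ × ℤ} : x ∈ cone ↔ x ∉ axis := Iff.rfl

theorem hitAfter_eq_coe {A : Set (ℤ × ℤ)} {T : ℕ∞} {ω : ℕ → ℤ × ℤ} {n : ℕ} (h1 : T < n)
    (h2 : ω n ∈ A) (h3 : ∀ k : ℕ, T < k → k < n → ω k ∉ A) : hitAfter A T ω = n := by
  refine le_antisymm (sInf_le ⟨n, ⟨h1, h2⟩, rfl⟩) (le_sInf ?_)
  rintro _ ⟨k, ⟨hk1, hk2⟩, rfl⟩
  by_contra hlt
  exact h3 k hk1 (ENat.natCast_lt_natCast.1 (not_le.1 hlt)) hk2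

theorem hitAfter_eq_top {A : Set (ℤ × ℤ)} {T : ℕ∞} {ω : ℕ → ℤ × ℤ}
    (h : ∀ k : ℕ, T < k → ω k ∉ A) : hitAfter A T ω = ⊤ := by
  unfold hitAfter
  rw [sInf_eq_top]
  rintro _ ⟨k, ⟨hk1, hk2⟩, rfl⟩
  exact absurd hk2 (h k hk1)

theorem exists_first_hit {A : Set (ℤ × ℤ)} {T : ℕ∞} {ω : ℕ → ℤ × ℤ}
    (h : ∃ k : ℕ, T < k ∧ ω k ∈ A) :
    ∃ n : ℕ, T < n ∧ ω n ∈ A ∧ ∀ k : ℕ, T < k → k < n → ω k ∉ A := by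
  classical
  exact ⟨Nat.find h, (Nat.find_spec h).1, (Nat.find_spec h).2,
    fun k hk hlt hA => Nat.find_min h hlt ⟨hk, hA⟩⟩

theorem hitAfter_eq_coe_iff {A : Set (ℤ × ℤ)} {T : ℕ∞} {ω : ℕ → ℤ × ℤ} {n : ℕ} :
    hitAfter A T ω = n ↔ T < n ∧ ω n ∈ A ∧ ∀ k : ℕ, T < k → k < n → ω k ∉ A := by
  refine ⟨fun h => ?_, fun ⟨h1, h2, h3⟩ => hitAfter_eq_coe h1 h2 h3⟩
  by_cases hex : ∃ k : ℕ, T < k ∧ ω k ∈ A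
  · obtain ⟨m, h1, h2, h3⟩ := exists_first_hit hex
    have := hitAfter_eq_coe h1 h2 h3
    rw [h] at this
    obtain rfl : n = m := by exact_mod_cast this
    exact ⟨h1, h2, h3⟩
  · push Not at hex
    rw [hitAfter_eq_top hex] at h
    exact absurd h (ENat.top_ne_natCast n)

theorem hitAfter_eq_top_iff {A : Set (ℤ × ℤ)} {T : ℕ∞} {ω : ℕ → ℤ × ℤ} :
    hitAfter A T ω = ⊤ ↔ ∀ k : ℕ, T < k → ω k ∉ A := by
  refine ⟨fun h => ?_, hitAfter_eq_top⟩
  by_contra hex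
  push Not at hex
  obtain ⟨m, h1, h2, h3⟩ := exists_first_hit hex
  rw [hitAfter_eq_coe h1 h2 h3] at h
  exact absurd h (ENat.natCast_ne_top m)

theorem hitAfter_add {A : Set (ℤ × ℤ)} (n : ℕ) (T : ℕ∞) (ω : ℕ → ℤ × ℤ) :
    hitAfter A (n + T) ω = n + hitAfter A T (shiftPath n ω) := by
  have key : ∀ k : ℕ, (n : ℕ∞) + T < ((n + k : ℕ) : ℕ∞) ↔ T < k := fun k => by
    rw [Nat.cast_add]
    exact WithTop.add_lt_add_iff_left (ENat.natCast_ne_top n)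
  by_cases hex : ∃ k : ℕ, T < k ∧ shiftPath n ω k ∈ A
  · obtain ⟨m, h1, h2, h3⟩ := exists_first_hit hex
    rw [hitAfter_eq_coe h1 h2 h3]
    have : hitAfter A (n + T) ω = ((n + m : ℕ) : ℕ∞) := by
      refine hitAfter_eq_coe ((key m).2 h1) h2 fun k hk hkm => ?_
      have hnk : n ≤ k := by
        have : (n : ℕ∞) < k := lt_of_le_of_lt le_self_add hk
        exact_mod_cast this.le
      obtain ⟨j, rfl⟩ := Nat.exists_eq_add_of_le hnk
      exact h3 j ((key j).1 hk) (by omega)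
    rw [this]; push_cast; rfl
  · push Not at hex
    rw [hitAfter_eq_top hex, add_top]
    refine hitAfter_eq_top fun k hk => ?_
    have hnk : n ≤ k := by
      have : (n : ℕ∞) < k := lt_of_le_of_lt le_self_add hk
      exact_mod_cast this.le
    obtain ⟨j, rfl⟩ := Nat.exists_eq_add_of_le hnk
    exact hex j ((key j).1 hk)

/-- The first positive time in `A`, as a natural number. -/
noncomputable def hit (A : Set (ℤ × ℤ)) (ω : ℕ → ℤ × ℤ) : ℕ := (hitAfter A 0 ω).toNat

theorem hit_eq {A : Set (ℤ × ℤ)} {ω : ℕ → ℤ × ℤ} {n : ℕ} (h1 : 0 < n)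
    (h2 : ω n ∈ A) (h3 : ∀ k : ℕ, 0 < k → k < n → ω k ∉ A) : hit A ω = n := by
  rw [hit, hitAfter_eq_coe (by exact_mod_cast h1) h2 fun k hk => h3 k (by exact_mod_cast hk)]
  rfl

theorem hit_spec {A : Set (ℤ × ℤ)} {ω : ℕ → ℤ × ℤ} (h : ∃ k > 0, ω k ∈ A) :
    0 < hit A ω ∧ ω (hit A ω) ∈ A ∧ ∀ k : ℕ, 0 < k → k < hit A ω → ω k ∉ A := by
  obtain ⟨k, hk, hkA⟩ := h
  obtain ⟨n, h1, h2, h3⟩ := exists_first_hit (T := 0) (A := A) (ω := ω)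
    ⟨k, by exact_mod_cast hk, hkA⟩
  have h1' : 0 < n := by exact_mod_cast h1
  have h3' : ∀ k : ℕ, 0 < k → k < n → ω k ∉ A := fun k hk => h3 k (by exact_mod_cast hk)
  rw [hit_eq h1' h2 h3']
  exact ⟨h1', h2, h3'⟩

theorem hitAfter_zero_eq_hit {A : Set (ℤ × ℤ)} {ω : ℕ → ℤ × ℤ} (h : ∃ k > 0, ω k ∈ A) :
    hitAfter A 0 ω = hit A ω := by
  obtain ⟨h1, h2, h3⟩ := hit_spec h
  exact hitAfter_eq_coe (by exact_mod_cast h1) h2 fun k hk => h3 k (by exact_mod_cast hk)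

theorem hitAfter_coe_eq_hit {A : Set (ℤ × ℤ)} {ω : ℕ → ℤ × ℤ} {n : ℕ} (h : ∃ k > n, ω k ∈ A) :
    hitAfter A n ω = ((n + hit A (shiftPath n ω) : ℕ) : ℕ∞) := by
  have := hitAfter_add (A := A) n 0 ω
  rw [add_zero] at this
  rw [this, hitAfter_zero_eq_hit, Nat.cast_add]
  obtain ⟨k, hk, hkA⟩ := h
  exact ⟨k - n, by omega, by rwa [shiftPath_apply, Nat.add_sub_of_le (le_of_lt hk)]⟩

theorem measurable_hitAfter (A : Set (ℤ × ℤ)) {T : (ℕ → ℤ × ℤ) → ℕ∞} (hT : Measurable T) :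
    Measurable fun ω => hitAfter A (T ω) ω := by
  have hlt : ∀ k : ℕ, MeasurableSet {ω | T ω < (k : ℕ∞)} := fun k =>
    hT (MeasurableSet.of_discrete (s := Set.Iio (k : ℕ∞)))
  have hA : ∀ k : ℕ, MeasurableSet {ω : ℕ → ℤ × ℤ | ω k ∈ A} := fun k =>
    measurable_pi_apply k (MeasurableSet.of_discrete (s := A))
  refine measurable_to_countable' fun n => ?_
  cases n using ENat.recTopCoe with
  | top =>
    have : (fun ω => hitAfter A (T ω) ω) ⁻¹' {⊤} =
        ⋂ k : ℕ, {ω | T ω < (k : ℕ∞)}ᶜ ∪ {ω : ℕ → ℤ × ℤ | ω k ∈ A}ᶜ := by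
      ext ω
      simp only [Set.mem_preimage, Set.mem_singleton_iff, hitAfter_eq_top_iff, Set.mem_iInter,
        Set.mem_union, Set.mem_compl_iff, Set.mem_ofPred_eq, imp_iff_not_or]
    rw [this]
    exact MeasurableSet.iInter fun k => (hlt k).compl.union (hA k).compl
  | coe n =>
    have : (fun ω => hitAfter A (T ω) ω) ⁻¹' {(n : ℕ∞)} =
        {ω | T ω < (n : ℕ∞)} ∩ ({ω : ℕ → ℤ × ℤ | ω n ∈ A} ∩
        ⋂ k : ℕ, {ω | T ω < (k : ℕ∞)}ᶜ ∪ ({_ω : ℕ → ℤ × ℤ | k < n}ᶜ ∪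
          {ω : ℕ → ℤ × ℤ | ω k ∈ A}ᶜ)) := by
      ext ω
      simp only [Set.mem_preimage, Set.mem_singleton_iff, hitAfter_eq_coe_iff, Set.mem_iInter,
        Set.mem_union, Set.mem_compl_iff, Set.mem_ofPred_eq, Set.mem_inter_iff, imp_iff_not_or]
    rw [this]
    exact (hlt n).inter ((hA n).inter (MeasurableSet.iInter fun k => (hlt k).compl.union
      ((MeasurableSet.const _).compl.union (hA k).compl)))

theorem measurable_hit (A : Set (ℤ × ℤ)) : Measurable (hit A) :=
  (Measurable.of_discrete (f := ENat.toNat)).comp (measurable_hitAfter A measurable_const)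

theorem measurable_apply_time {N : (ℕ → ℤ × ℤ) → ℕ} (hN : Measurable N) :
    Measurable fun ω : ℕ → ℤ × ℤ => ω (N ω) := by
  have : Measurable fun q : (ℕ → ℤ × ℤ) × ℕ => q.1 q.2 :=
    measurable_from_prod_countable_left fun n => measurable_pi_apply n
  exact this.comp (measurable_id.prodMk hN)

theorem measurable_shiftPath_time {N : (ℕ → ℤ × ℤ) → ℕ} (hN : Measurable N) :
    Measurable fun ω : ℕ → ℤ × ℤ => shiftPath (N ω) ω :=
  measurable_pi_lambda _ fun _ => measurable_apply_time (hN.add_const _)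

/-- The number of times `1 ≤ i ≤ n` at which the trajectory is in `A`. -/
noncomputable def visits (A : Set (ℤ × ℤ)) (n : ℕ) (ω : ℕ → ℤ × ℤ) : ℕ :=
  ∑ i ∈ Finset.range n, A.indicator 1 (ω (i + 1))

theorem localTime_coe (A : Set (ℤ × ℤ)) (n : ℕ) (ω : ℕ → ℤ × ℤ) :
    localTime A n ω = visits A n ω := by
  classical
  have h : {i : ℕ | 1 ≤ i ∧ (i : ℕ∞) ≤ n ∧ ω i ∈ A} =
      (((Finset.range n).filter fun i => ω (i + 1) ∈ A).image (· + 1) : Finset ℕ) := by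
    ext i
    simp only [Set.mem_ofPred_eq, Finset.coe_image, Finset.coe_filter, Finset.mem_range,
      Set.mem_image, Nat.cast_le]
    constructor
    · rintro ⟨h1, h2, h3⟩
      exact ⟨i - 1, ⟨by omega, by rwa [Nat.sub_add_cancel h1]⟩, Nat.sub_add_cancel h1⟩
    · rintro ⟨j, ⟨h1, h2⟩, rfl⟩
      exact ⟨by omega, by omega, h2⟩
  rw [localTime, h, Set.encard_coe_eq_coe_finsetCard,
    Finset.card_image_of_injective _ (add_left_injective 1), Finset.card_filter, visits]
  congr 1

theorem visits_add (A : Set (ℤ × ℤ)) (m n : ℕ) (ω : ℕ → ℤ × ℤ) :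
    visits A (m + n) ω = visits A m ω + visits A n (shiftPath m ω) := by
  simp only [visits, Finset.sum_range_add, shiftPath_apply, add_assoc]

theorem visits_le (A : Set (ℤ × ℤ)) (n : ℕ) (ω : ℕ → ℤ × ℤ) : visits A n ω ≤ n := by
  classical
  calc visits A n ω ≤ ∑ i ∈ Finset.range n, 1 := Finset.sum_le_sum fun i _ => by
        rw [Set.indicator_apply]; split_ifs <;> simp
    _ = n := by simp

theorem visits_congr (A : Set (ℤ × ℤ)) {n : ℕ} {ω ω' : ℕ → ℤ × ℤ} (h : ∀ i ≤ n, ω i = ω' i) :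
    visits A n ω = visits A n ω' :=
  Finset.sum_congr rfl fun i hi => by rw [h _ (Finset.mem_range.1 hi)]

theorem measurable_visits (A : Set (ℤ × ℤ)) {N : (ℕ → ℤ × ℤ) → ℕ} (hN : Measurable N) :
    Measurable fun ω => visits A (N ω) ω := by
  have : Measurable fun q : (ℕ → ℤ × ℤ) × ℕ => visits A q.2 q.1 := by
    refine measurable_from_prod_countable_left fun n => ?_
    have h1 : ∀ i ∈ Finset.range n,
        Measurable fun ω : ℕ → ℤ × ℤ => A.indicator (1 : ℤ × ℤ → ℕ) (ω (i + 1)) := fun i _ => by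
      have h2 : Measurable fun ω : ℕ → ℤ × ℤ => ω (i + 1) := measurable_pi_apply _
      exact (Measurable.of_discrete (f := A.indicator (1 : ℤ × ℤ → ℕ))).comp h2
    exact Finset.measurable_fun_sum _ h1
  exact this.comp (measurable_id.prodMk hN)

/-- A trajectory is regular if it visits the axis and the cones infinitely often and never steps
from a cone to the origin. -/
def IsRegular (ω : ℕ → ℤ × ℤ) : Prop :=
  (∀ n, ∃ k > n, ω k ∈ axis) ∧ (∀ n, ∃ k > n, ω k ∈ cone) ∧ ∀ n, ω n ∈ cone → ω (n + 1) ≠ (0, 0)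

theorem IsRegular.shiftPath {ω : ℕ → ℤ × ℤ} (h : IsRegular ω) (n : ℕ) :
    IsRegular (shiftPath n ω) := by
  refine ⟨fun m => ?_, fun m => ?_, fun m => h.2.2 (n + m)⟩
  · obtain ⟨k, hk, hkA⟩ := h.1 (n + m)
    exact ⟨k - n, by omega, by rwa [shiftPath_apply, Nat.add_sub_of_le (by omega)]⟩
  · obtain ⟨k, hk, hkA⟩ := h.2.1 (n + m)
    exact ⟨k - n, by omega, by rwa [shiftPath_apply, Nat.add_sub_of_le (by omega)]⟩

/-! ### One-step means and the superharmonic bound -/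

/-- The `ℓ¹` norm on `ℤ²`. -/
def taxiNorm (x : ℤ × ℤ) : ℤ := |x.1| + |x.2|

theorem taxiNorm_nonneg (x : ℤ × ℤ) : 0 ≤ taxiNorm x := add_nonneg (abs_nonneg _) (abs_nonneg _)

theorem axis_iff {x : ℤ × ℤ} : x ∈ axis ↔ x.1 = 0 ∨ x.2 = 0 := mul_eq_zero

theorem cone_iff {x : ℤ × ℤ} : x ∈ cone ↔ x.1 ≠ 0 ∧ x.2 ≠ 0 := mul_ne_zero_iff

theorem taxiNorm_eq_maxNorm {x : ℤ × ℤ} (h : x ∈ axis) : taxiNorm x = maxNorm x := by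
  rw [axis_iff] at h
  simp only [taxiNorm, maxNorm, Int.abs_eq_natAbs]
  omega

theorem transProb_of_uniform {α : ℝ≥0} {x y : ℤ × ℤ} (h : x ∈ cone ∨ x = (0, 0))
    (hy : y ∈ neighbors x) : transProb α x y = 1 / 4 := by
  have : x.1 * x.2 ≠ 0 ∨ x = (0, 0) := h
  simp only [transProb, hy, if_true, if_pos this]

theorem sum_transProb_uniform (α : ℝ≥0) {x : ℤ × ℤ} (h : x ∈ cone ∨ x = (0, 0))
    (f : ℤ × ℤ → ℝ) :
    ∑ y ∈ neighbors x, transProb α x y * f y =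
      (f (x.1 + 1, x.2) + f (x.1 - 1, x.2) + f (x.1, x.2 + 1) + f (x.1, x.2 - 1)) / 4 := by
  rw [Finset.sum_congr rfl fun y hy => by rw [transProb_of_uniform h hy], sum_neighbors]
  ring

/-- The step of the walk from a point of the axis other than the origin: one inner and one outer
neighbour on the axis, two neighbours in the cones. -/
theorem sum_transProb_axis {x : ℤ × ℤ} (hx : x ∈ axis) (h0 : x ≠ (0, 0)) :
    ∃ a b c d : ℤ × ℤ, a ∈ axis ∧ b ∈ axis ∧ c ∈ cone ∧ d ∈ cone ∧
      maxNorm a = maxNorm x - 1 ∧ maxNorm b = maxNorm x + 1 ∧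
      taxiNorm c = maxNorm x + 1 ∧ taxiNorm d = maxNorm x + 1 ∧
      ∀ (α : ℝ≥0) (f : ℤ × ℤ → ℝ), ∑ y ∈ neighbors x, transProb α x y * f y =
        (1 - 3 / (4 * (maxNorm x : ℝ) ^ (α : ℝ))) * f a +
          1 / (4 * (maxNorm x : ℝ) ^ (α : ℝ)) * (f b + f c + f d) := by
  have hc : ¬ (x.1 * x.2 ≠ 0 ∨ x = (0, 0)) := by
    rintro (h | h)
    · exact h hx
    · exact h0 h
  have key : ∀ (α : ℝ≥0) (f : ℤ × ℤ → ℝ), ∑ y ∈ neighbors x, transProb α x y * f y =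
      ∑ y ∈ neighbors x, (if maxNorm y < maxNorm x then 1 - 3 / (4 * (maxNorm x : ℝ) ^ (α : ℝ))
        else 1 / (4 * (maxNorm x : ℝ) ^ (α : ℝ))) * f y := fun α f =>
    Finset.sum_congr rfl fun y hy => by simp only [transProb, hy, if_true, if_neg hc]
  simp only [key, sum_neighbors]
  clear key hc
  obtain ⟨a, b⟩ := x
  rw [axis_iff] at hx
  simp only at hx
  rcases hx with rfl | rfl
  · have hb : b ≠ 0 := fun hb => h0 (by rw [hb])
    rcases lt_or_gt_of_ne hb with hb | hb
    · refine ⟨(0, b + 1), (0, b - 1), (1, b), (-1, b), Or.inl rfl |> axis_iff.2,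
        Or.inl rfl |> axis_iff.2, cone_iff.2 ⟨by simp, hb.ne⟩, cone_iff.2 ⟨by simp, hb.ne⟩,
        by simp only [maxNorm, Int.abs_eq_natAbs]; omega,
        by simp only [maxNorm, Int.abs_eq_natAbs]; omega,
        by simp only [taxiNorm, maxNorm, Int.abs_eq_natAbs]; omega,
        by simp only [taxiNorm, maxNorm, Int.abs_eq_natAbs]; omega, fun α f => ?_⟩
      rw [if_neg (by simp only [maxNorm, Int.abs_eq_natAbs]; omega),
        if_neg (by simp only [maxNorm, Int.abs_eq_natAbs]; omega),
        if_pos (by simp only [maxNorm, Int.abs_eq_natAbs]; omega),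
        if_neg (by simp only [maxNorm, Int.abs_eq_natAbs]; omega)]
      simp only [zero_add, zero_sub]
      ring
    · refine ⟨(0, b - 1), (0, b + 1), (1, b), (-1, b), Or.inl rfl |> axis_iff.2,
        Or.inl rfl |> axis_iff.2, cone_iff.2 ⟨by simp, hb.ne'⟩, cone_iff.2 ⟨by simp, hb.ne'⟩,
        by simp only [maxNorm, Int.abs_eq_natAbs]; omega,
        by simp only [maxNorm, Int.abs_eq_natAbs]; omega,
        by simp only [taxiNorm, maxNorm, Int.abs_eq_natAbs]; omega,
        by simp only [taxiNorm, maxNorm, Int.abs_eq_natAbs]; omega, fun α f => ?_⟩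
      rw [if_neg (by simp only [maxNorm, Int.abs_eq_natAbs]; omega),
        if_neg (by simp only [maxNorm, Int.abs_eq_natAbs]; omega),
        if_neg (by simp only [maxNorm, Int.abs_eq_natAbs]; omega),
        if_pos (by simp only [maxNorm, Int.abs_eq_natAbs]; omega)]
      simp only [zero_add, zero_sub]
      ring
  · have ha : a ≠ 0 := fun ha => h0 (by rw [ha])
    rcases lt_or_gt_of_ne ha with ha | ha
    · refine ⟨(a + 1, 0), (a - 1, 0), (a, 1), (a, -1), Or.inr rfl |> axis_iff.2,
        Or.inr rfl |> axis_iff.2, cone_iff.2 ⟨ha.ne, by simp⟩, cone_iff.2 ⟨ha.ne, by simp⟩,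
        by simp only [maxNorm, Int.abs_eq_natAbs]; omega,
        by simp only [maxNorm, Int.abs_eq_natAbs]; omega,
        by simp only [taxiNorm, maxNorm, Int.abs_eq_natAbs]; omega,
        by simp only [taxiNorm, maxNorm, Int.abs_eq_natAbs]; omega, fun α f => ?_⟩
      rw [if_pos (by simp only [maxNorm, Int.abs_eq_natAbs]; omega),
        if_neg (by simp only [maxNorm, Int.abs_eq_natAbs]; omega),
        if_neg (by simp only [maxNorm, Int.abs_eq_natAbs]; omega),
        if_neg (by simp only [maxNorm, Int.abs_eq_natAbs]; omega)]
      simp only [zero_add, zero_sub]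
      ring
    · refine ⟨(a - 1, 0), (a + 1, 0), (a, 1), (a, -1), Or.inr rfl |> axis_iff.2,
        Or.inr rfl |> axis_iff.2, cone_iff.2 ⟨ha.ne', by simp⟩, cone_iff.2 ⟨ha.ne', by simp⟩,
        by simp only [maxNorm, Int.abs_eq_natAbs]; omega,
        by simp only [maxNorm, Int.abs_eq_natAbs]; omega,
        by simp only [taxiNorm, maxNorm, Int.abs_eq_natAbs]; omega,
        by simp only [taxiNorm, maxNorm, Int.abs_eq_natAbs]; omega, fun α f => ?_⟩
      rw [if_neg (by simp only [maxNorm, Int.abs_eq_natAbs]; omega),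
        if_pos (by simp only [maxNorm, Int.abs_eq_natAbs]; omega),
        if_neg (by simp only [maxNorm, Int.abs_eq_natAbs]; omega),
        if_neg (by simp only [maxNorm, Int.abs_eq_natAbs]; omega)]
      simp only [zero_add, zero_sub]
      ring

theorem sum_stepProb_ofReal (α : ℝ≥0) (x : ℤ × ℤ) {v : ℤ × ℤ → ℝ} (hv : ∀ y, 0 ≤ v y) :
    ∑ y ∈ neighbors x, stepProb α x y * ENNReal.ofReal (v y) =
      ENNReal.ofReal (∑ y ∈ neighbors x, transProb α x y * v y) := by
  rw [ENNReal.ofReal_sum_of_nonneg fun y _ => mul_nonneg (transProb_nonneg α x y) (hv y)]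
  exact Finset.sum_congr rfl fun y _ => (ENNReal.ofReal_mul (transProb_nonneg α x y)).symm

open scoped Classical in
/-- The cost `c` per unit of time until the walk enters `A`, plus `V` at the entrance point, stopped
at time `n`. -/
noncomputable def stoppedCost (A : Set (ℤ × ℤ)) (c : ℝ≥0∞) (V : ℤ × ℤ → ℝ≥0∞) :
    ℕ → (ℕ → ℤ × ℤ) → ℝ≥0∞
  | 0, _ => 0
  | n + 1, ω => c + if ω 1 ∈ A then V (ω 1) else stoppedCost A c V n (shiftPath 1 ω)

theorem measurable_stoppedCost (A : Set (ℤ × ℤ)) (c : ℝ≥0∞) (V : ℤ × ℤ → ℝ≥0∞) (n : ℕ) :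
    Measurable (stoppedCost A c V n) := by
  classical
  induction n with
  | zero => exact measurable_const
  | succ n ih =>
    have h1 : Measurable fun ω : ℕ → ℤ × ℤ => ω 1 := measurable_pi_apply _
    refine Measurable.const_add (Measurable.ite (h1 (MeasurableSet.of_discrete (s := A))) ?_ ?_) c
    · exact (Measurable.of_discrete (f := V)).comp h1
    · exact ih.comp (measurable_shiftPath 1)

/-- The one-step inequality for `V` is iterated over the horizon. Horizon `0` is given cost `0`
instead of `V`, so nonnegativity of `V` suffices to start. -/
theorem lintegral_stoppedCost_le {α : ℝ≥0} {A : Set (ℤ × ℤ)} {c : ℝ≥0∞} {V : ℤ × ℤ → ℝ≥0∞}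
    (h : ∀ x, x ∉ A → c + ∑ y ∈ neighbors x, stepProb α x y * V y ≤ V x) (n : ℕ) :
    ∀ x, x ∉ A → ∫⁻ ω, stoppedCost A c V n ω ∂(walkLaw α x) ≤ V x := by
  induction n with
  | zero => intro x _; simp [stoppedCost]
  | succ n ih =>
    intro x hx
    rw [lintegral_walkLaw_step α x (measurable_stoppedCost A c V (n + 1))]
    refine le_trans ?_ (h x hx)
    calc ∑ y ∈ neighbors x, stepProb α x y *
          ∫⁻ ω, stoppedCost A c V (n + 1) (consPath x ω) ∂(walkLaw α y)
        ≤ ∑ y ∈ neighbors x, stepProb α x y * (c + V y) := by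
          refine Finset.sum_le_sum fun y _ => ?_
          gcongr
          by_cases hy : y ∈ A
          · have : ∀ᵐ ω ∂(walkLaw α y), stoppedCost A c V (n + 1) (consPath x ω) = c + V y := by
              filter_upwards [ae_start α y] with ω hω
              simp [stoppedCost, hω, hy]
            rw [lintegral_congr_ae this]; simp
          · have : ∀ᵐ ω ∂(walkLaw α y), stoppedCost A c V (n + 1) (consPath x ω) =
                c + stoppedCost A c V n ω := by
              filter_upwards [ae_start α y] with ω hω
              simp [stoppedCost, hω, hy, shiftPath_succ_consPath 0]
            rw [lintegral_congr_ae this, lintegral_add_left measurable_const]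
            simp only [lintegral_const, measure_univ, mul_one]
            gcongr
            exact ih y hy
      _ = c + ∑ y ∈ neighbors x, stepProb α x y * V y := by
          simp only [mul_add, Finset.sum_add_distrib]
          rw [← Finset.sum_mul, sum_stepProb, one_mul]

theorem stoppedCost_of_hit {A : Set (ℤ × ℤ)} {c : ℝ≥0∞} {V : ℤ × ℤ → ℝ≥0∞} {n m : ℕ} (hnm : n ≤ m)
    (hn : 0 < n) {ω : ℕ → ℤ × ℤ} (h1 : ω n ∈ A) (h2 : ∀ k : ℕ, 0 < k → k < n → ω k ∉ A) :
    stoppedCost A c V m ω = n * c + V (ω n) := by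
  induction m generalizing n ω with
  | zero => omega
  | succ m ih =>
    rw [stoppedCost]
    rcases Nat.lt_or_ge 1 n with hlt | hle
    · rw [if_neg (h2 1 one_pos hlt)]
      obtain ⟨k, rfl⟩ : ∃ k, n = 1 + k := ⟨n - 1, by omega⟩
      rw [ih (n := k) (ω := shiftPath 1 ω) (by omega) (by omega) h1
        fun j hj hjk => h2 (1 + j) (by omega) (by omega), shiftPath_apply, ← add_assoc]
      push_cast
      ring
    · obtain rfl : n = 1 := by omega
      simp [h1]

theorem stoppedCost_of_not_hit {A : Set (ℤ × ℤ)} {c : ℝ≥0∞} {V : ℤ × ℤ → ℝ≥0∞} (m : ℕ)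
    {ω : ℕ → ℤ × ℤ} (h : ∀ k : ℕ, 0 < k → ω k ∉ A) : stoppedCost A c V m ω = m * c := by
  induction m generalizing ω with
  | zero => simp [stoppedCost]
  | succ m ih =>
    rw [stoppedCost, if_neg (h 1 one_pos), ih (ω := shiftPath 1 ω) fun k hk => h (1 + k) (by omega)]
    push_cast
    ring

/-- A nonnegative function `V` that decreases by at least `c` in the mean at every step outside `A`
dominates the expected cost until the entrance in `A`. -/
theorem lintegral_le_of_superharmonic {α : ℝ≥0} {A : Set (ℤ × ℤ)} {c : ℝ≥0∞}
    {V : ℤ × ℤ → ℝ≥0∞} (h : ∀ x, x ∉ A → c + ∑ y ∈ neighbors x, stepProb α x y * V y ≤ V x)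
    {Φ : (ℕ → ℤ × ℤ) → ℝ≥0∞}
    (hhit : ∀ ω, (∃ k > 0, ω k ∈ A) → Φ ω ≤ hit A ω * c + V (ω (hit A ω)))
    (hnot : ∀ ω, (¬ ∃ k > 0, ω k ∈ A) → Φ ω ≤ ⊤ * c) {x : ℤ × ℤ} (hx : x ∉ A) :
    ∫⁻ ω, Φ ω ∂(walkLaw α x) ≤ V x := by
  -- Fatou's lemma along the horizons: the stopped cost is eventually constant if `A` is hit, and
  -- equals `n * c` otherwise. For `c = 0` the latter limit is `⊤ * 0 = 0`.
  calc ∫⁻ ω, Φ ω ∂(walkLaw α x)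
      ≤ ∫⁻ ω, liminf (fun n => stoppedCost A c V n ω) atTop ∂(walkLaw α x) := by
        refine lintegral_mono fun ω => ?_
        by_cases hω : ∃ k > 0, ω k ∈ A
        · refine (hhit ω hω).trans (le_of_eq ?_)
          obtain ⟨h1, h2, h3⟩ := hit_spec hω
          refine (Tendsto.liminf_eq (tendsto_const_nhds.congr' ?_)).symm
          filter_upwards [eventually_ge_atTop (hit A ω)] with m hm
          exact (stoppedCost_of_hit hm h1 h2 h3).symm
        · refine (hnot ω hω).trans (le_of_eq ?_)
          push Not at hω
          refine (Tendsto.liminf_eq ?_).symm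
          simp only [stoppedCost_of_not_hit _ hω]
          exact ENNReal.Tendsto.mul_const ENNReal.tendsto_nat_nhds_top (Or.inl ENNReal.top_ne_zero)
    _ ≤ liminf (fun n => ∫⁻ ω, stoppedCost A c V n ω ∂(walkLaw α x)) atTop :=
        lintegral_liminf_le fun n => measurable_stoppedCost A c V n
    _ ≤ V x := by
        refine liminf_le_of_le ?_ fun b hb => ?_
        · exact ⟨0, by simp⟩
        · obtain ⟨n, hn⟩ := hb.exists
          exact hn.trans (lintegral_stoppedCost_le h n x hx)

theorem walkLaw_step (α : ℝ≥0) (x : ℤ × ℤ) {s : Set (ℕ → ℤ × ℤ)} (hs : MeasurableSet s) :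
    walkLaw α x s = ∑ y ∈ neighbors x, stepProb α x y * walkLaw α y (consPath x ⁻¹' s) := by
  conv_lhs => rw [walkLaw_eq_sum]
  simp [Measure.finsetSum_apply, Measure.map_apply (measurable_consPath x) hs]

/-! ### The walk leaves the cones almost surely -/

/-- The trajectories that do not visit `A` at positive times. -/
def avoiding (A : Set (ℤ × ℤ)) : Set (ℕ → ℤ × ℤ) := {ω | ∀ k > 0, ω k ∉ A}

theorem measurableSet_avoiding (A : Set (ℤ × ℤ)) : MeasurableSet (avoiding A) := by
  have : avoiding A = ⋂ k : ℕ, ⋂ _ : k > 0, {ω : ℕ → ℤ × ℤ | ω k ∈ Aᶜ} := by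
    ext ω; simp [avoiding]
  rw [this]
  exact MeasurableSet.iInter fun k => MeasurableSet.iInter fun _ =>
    measurable_pi_apply k (MeasurableSet.of_discrete (s := Aᶜ))

/-- Avoidance does not test time `0`; once a point is put in front, the start `y` sits at time `1`
and is tested, whence the indicator. -/
theorem walkLaw_consPath_avoiding (α : ℝ≥0) (A : Set (ℤ × ℤ)) (x y : ℤ × ℤ) :
    walkLaw α y (consPath x ⁻¹' avoiding A) = Aᶜ.indicator (fun y => walkLaw α y (avoiding A)) y := by
  have key : ∀ ω : ℕ → ℤ × ℤ, ω ∈ consPath x ⁻¹' avoiding A ↔ ω 0 ∉ A ∧ ω ∈ avoiding A := by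
    intro ω
    constructor
    · intro h
      exact ⟨h 1 one_pos, fun k hk => h (k + 1) (by omega)⟩
    · rintro ⟨h0, h⟩ k hk
      obtain ⟨j, rfl⟩ : ∃ j, k = j + 1 := ⟨k - 1, by omega⟩
      rcases Nat.eq_zero_or_pos j with rfl | hj
      · exact h0
      · exact h j hj
  by_cases hy : y ∈ A
  · rw [Set.indicator_of_notMem (by simpa using hy), measure_eq_zero_iff_ae_notMem]
    filter_upwards [ae_start α y] with ω hω h
    exact ((key ω).1 h).1 (hω ▸ hy)
  · rw [Set.indicator_of_mem (by simpa using hy)]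
    refine measure_congr ?_
    filter_upwards [ae_start α y] with ω hω
    refine propext ((key ω).trans ⟨fun h => h.2, fun h => ⟨hω ▸ hy, h⟩⟩)

theorem walkLaw_avoiding (α : ℝ≥0) (A : Set (ℤ × ℤ)) (x : ℤ × ℤ) :
    walkLaw α x (avoiding A) =
      ∑ y ∈ neighbors x, stepProb α x y * Aᶜ.indicator (fun y => walkLaw α y (avoiding A)) y := by
  rw [walkLaw_step α x (measurableSet_avoiding A)]
  exact Finset.sum_congr rfl fun y _ => by rw [walkLaw_consPath_avoiding]

/-- A strictly superharmonic function on the cones that tends to infinity. -/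
noncomputable def barrier (x : ℤ × ℤ) : ℝ := taxiNorm x + (1 - (1 / 2) ^ x.1.natAbs)

theorem taxiNorm_le_barrier (x : ℤ × ℤ) : taxiNorm x ≤ barrier x := by
  have : ((1 : ℝ) / 2) ^ x.1.natAbs ≤ 1 := pow_le_one₀ (by norm_num) (by norm_num)
  unfold barrier
  linarith

theorem sum_taxiNorm {x : ℤ × ℤ} (hx : x ∈ cone) :
    taxiNorm (x.1 + 1, x.2) + taxiNorm (x.1 - 1, x.2) + taxiNorm (x.1, x.2 + 1) +
      taxiNorm (x.1, x.2 - 1) = 4 * taxiNorm x := by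
  obtain ⟨h1, h2⟩ := cone_iff.1 hx
  simp only [taxiNorm, Int.abs_eq_natAbs]
  omega

/-- The `ℓ¹` norm is harmonic in the cones. For `(1/2) ^ |x.1|` the two horizontal neighbours sum to
`5/2` times the central value and the vertical ones to `2` times, so the total exceeds `4` times and
the subtracted term makes the inequality strict. -/
theorem sum_barrier_lt {x : ℤ × ℤ} (hx : x ∈ cone) :
    barrier (x.1 + 1, x.2) + barrier (x.1 - 1, x.2) + barrier (x.1, x.2 + 1) +
      barrier (x.1, x.2 - 1) < 4 * barrier x := by
  have ht : (taxiNorm (x.1 + 1, x.2) : ℝ) + taxiNorm (x.1 - 1, x.2) + taxiNorm (x.1, x.2 + 1) +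
      taxiNorm (x.1, x.2 - 1) = 4 * taxiNorm x := by exact_mod_cast sum_taxiNorm hx
  have hp : ((1 : ℝ) / 2) ^ (x.1 + 1).natAbs + (1 / 2) ^ (x.1 - 1).natAbs =
      5 / 2 * (1 / 2) ^ x.1.natAbs := by
    obtain ⟨h1, -⟩ := cone_iff.1 hx
    obtain ⟨k, hk⟩ : ∃ k, x.1.natAbs = k + 1 := ⟨x.1.natAbs - 1, by omega⟩
    rcases lt_or_gt_of_ne h1 with h | h
    · rw [hk, show (x.1 + 1).natAbs = k by omega, show (x.1 - 1).natAbs = k + 2 by omega]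
      ring
    · rw [hk, show (x.1 + 1).natAbs = k + 2 by omega, show (x.1 - 1).natAbs = k by omega]
      ring
  have hpos : (0 : ℝ) < (1 / 2) ^ x.1.natAbs := by positivity
  simp only [barrier]
  linarith

/-- Maximum principle: the avoidance probability, set to zero on the axis, is bounded and satisfies
the mean value property on the cones. Comparison with `ε * barrier` bounds it by `ε * barrier x`,
and `ε` tends to zero. -/
theorem walkLaw_avoiding_axis_of_cone (α : ℝ≥0) {x : ℤ × ℤ} (hx : x ∈ cone) :
    walkLaw α x (avoiding axis) = 0 := by
  classical
  set N : ℤ × ℤ → ℝ := fun y => (walkLaw α y (avoiding axis)).toReal with hN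
  set N' : ℤ × ℤ → ℝ := cone.indicator N with hN'
  have hN1 : ∀ y, N y ≤ 1 := fun y => ENNReal.toReal_le_of_le_ofReal zero_le_one (by
    rw [ENNReal.ofReal_one]; exact prob_le_one)
  have hharm : ∀ z ∈ cone, N z = (N' (z.1 + 1, z.2) + N' (z.1 - 1, z.2) + N' (z.1, z.2 + 1) +
      N' (z.1, z.2 - 1)) / 4 := by
    intro z hz
    rw [← sum_transProb_uniform α (Or.inl hz) N', hN]
    simp only
    rw [walkLaw_avoiding, ENNReal.toReal_sum]
    · refine Finset.sum_congr rfl fun y _ => ?_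
      rw [ENNReal.toReal_mul, stepProb, ENNReal.toReal_ofReal (transProb_nonneg α z y)]
      congr 1
      by_cases hy : y ∈ cone
      · rw [hN', Set.indicator_of_mem hy, Set.indicator_of_mem (show y ∈ axisᶜ from hy)]
      · rw [hN', Set.indicator_of_notMem hy, Set.indicator_of_notMem (show y ∉ axisᶜ from hy)]
        rfl
    · intro y _
      refine ENNReal.mul_ne_top ENNReal.ofReal_ne_top ?_
      rw [Set.indicator_apply]
      split_ifs
      · exact measure_ne_top _ _
      · exact ENNReal.zero_ne_top
  have main : ∀ ε : ℝ, 0 < ε → N x ≤ ε * barrier x := by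
    intro ε hε
    by_contra hlt
    push Not at hlt
    -- Outside the box of radius `R` the barrier is at least `R > 1 / ε`, so `ε * barrier` exceeds
    -- any probability there.
    obtain ⟨R, hR⟩ := exists_nat_gt (1 / ε)
    set B : Finset (ℤ × ℤ) :=
      (Finset.Icc (-(R : ℤ)) R ×ˢ Finset.Icc (-(R : ℤ)) R).filter (· ∈ cone) with hB
    have hout : ∀ y ∈ cone, y ∉ B → N y ≤ ε * barrier y := by
      intro y hy hyB
      have h1 : (R : ℤ) ≤ taxiNorm y := by
        by_contra hlt
        apply hyB
        simp only [hB, Finset.mem_filter, Finset.mem_product, Finset.mem_Icc]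
        simp only [taxiNorm, Int.abs_eq_natAbs] at hlt
        exact ⟨⟨⟨by omega, by omega⟩, by omega, by omega⟩, hy⟩
      have h2 : (R : ℝ) ≤ barrier y := le_trans (by exact_mod_cast h1) (taxiNorm_le_barrier y)
      calc N y ≤ 1 := hN1 y
        _ = ε * (1 / ε) := by field_simp
        _ ≤ ε * barrier y := by gcongr; linarith
    have hxB : x ∈ B := by
      by_contra hxB
      exact absurd (hout x hx hxB) (not_le.2 hlt)
    -- A positive maximum of `N - ε * barrier` contradicts strict superharmonicity already at the
    -- maximiser, so no propagation along neighbours is needed.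
    obtain ⟨z, hzB, hz⟩ := Finset.exists_max_image B (fun y => N y - ε * barrier y) ⟨x, hxB⟩
    have hzc : z ∈ cone := (Finset.mem_filter.1 hzB).2
    have hpos : 0 < N z - ε * barrier z := lt_of_lt_of_le (by linarith) (hz x hxB)
    have hle : ∀ y, N' y ≤ (N z - ε * barrier z) + ε * barrier y := by
      intro y
      have hb : 0 ≤ ε * barrier y := mul_nonneg hε.le
        (le_trans (by exact_mod_cast taxiNorm_nonneg y) (taxiNorm_le_barrier y))
      by_cases hy : y ∈ cone
      · rw [hN', Set.indicator_of_mem hy]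
        by_cases hyB : y ∈ B
        · linarith [hz y hyB]
        · linarith [hout y hy hyB]
      · rw [hN', Set.indicator_of_notMem hy]
        linarith
    have h1 := hharm z hzc
    have h2 := mul_lt_mul_of_pos_left (sum_barrier_lt hzc) hε
    linarith [hle (z.1 + 1, z.2), hle (z.1 - 1, z.2), hle (z.1, z.2 + 1), hle (z.1, z.2 - 1)]
  have h0 : N x ≤ 0 := by
    have hlim : Tendsto (fun ε : ℝ => ε * barrier x) (𝓝[>] 0) (𝓝 0) := by
      have : Tendsto (fun ε : ℝ => ε * barrier x) (𝓝 0) (𝓝 (0 * barrier x)) :=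
        tendsto_id.mul_const _
      rw [zero_mul] at this
      exact this.mono_left nhdsWithin_le_nhds
    refine ge_of_tendsto hlim ?_
    filter_upwards [self_mem_nhdsWithin] with ε hε
    exact main ε hε
  have h1 : N x = 0 := le_antisymm h0 ENNReal.toReal_nonneg
  exact ((ENNReal.toReal_eq_zero_iff _).1 h1).resolve_right (measure_ne_top _ _)

theorem walkLaw_avoiding_axis (α : ℝ≥0) (x : ℤ × ℤ) : walkLaw α x (avoiding axis) = 0 := by
  rw [walkLaw_avoiding]
  refine Finset.sum_eq_zero fun y _ => ?_
  by_cases hy : y ∈ axis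
  · rw [Set.indicator_of_notMem (by simpa using hy), mul_zero]
  · rw [Set.indicator_of_mem (by simpa using hy), walkLaw_avoiding_axis_of_cone α hy, mul_zero]

/-! ### Lyapunov functions for the sojourn on the axis -/

theorem pow_three_le_rpow {α : ℝ≥0} (hα : 3 < α) {r : ℝ} (hr : 1 ≤ r) : r ^ 3 ≤ r ^ (α : ℝ) := by
  have h : (3 : ℝ) ≤ α := by exact_mod_cast hα.le
  calc r ^ 3 = r ^ (3 : ℝ) := by norm_cast
    _ ≤ r ^ (α : ℝ) := Real.rpow_le_rpow_of_exponent_le hr h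

theorem zero_notMem_cone : ((0, 0) : ℤ × ℤ) ∉ cone := fun h => h (by simp)

theorem neighbor_zero_mem_axis {y : ℤ × ℤ} (h : y ∈ neighbors (0, 0)) : y ∈ axis ∧ maxNorm y = 1 := by
  simp only [neighbors, Finset.mem_insert, Finset.mem_singleton] at h
  rcases h with rfl | rfl | rfl | rfl <;> exact ⟨by simp [axis_iff], by simp [maxNorm]⟩

theorem sum_transProb_zero_le (α : ℝ≥0) {f : ℤ × ℤ → ℝ} {b : ℝ}
    (h : ∀ y ∈ axis, maxNorm y = 1 → f y ≤ b) :
    ∑ y ∈ neighbors (0, 0), transProb α (0, 0) y * f y ≤ b := by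
  calc ∑ y ∈ neighbors (0, 0), transProb α (0, 0) y * f y
      ≤ ∑ y ∈ neighbors (0, 0), transProb α (0, 0) y * b := by
        refine Finset.sum_le_sum fun y hy => ?_
        have := neighbor_zero_mem_axis hy
        exact mul_le_mul_of_nonneg_left (h y this.1 this.2) (transProb_nonneg _ _ _)
    _ = b := by rw [← Finset.sum_mul, sum_transProb, one_mul]

open scoped Classical in
/-- A bound for the mean time that the walk spends on the axis. -/
noncomputable def sojournBound (x : ℤ × ℤ) : ℝ :=
  if x ∈ cone then 0 else if x = (0, 0) then 5 else 2 + 2 * maxNorm x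

theorem sojournBound_nonneg (x : ℤ × ℤ) : 0 ≤ sojournBound x := by
  unfold sojournBound
  have : (0 : ℝ) ≤ maxNorm x := by exact_mod_cast (abs_nonneg x.1).trans (le_max_left _ _)
  split_ifs <;> linarith

theorem maxNorm_eq_zero_iff {x : ℤ × ℤ} : maxNorm x = 0 ↔ x = (0, 0) := by
  constructor
  · intro h
    by_contra hne
    have := maxNorm_pos_of_ne hne
    omega
  · rintro rfl; simp [maxNorm]

theorem axis_notMem_cone {x : ℤ × ℤ} (hx : x ∈ axis) : x ∉ cone := fun h => h hx

theorem sojournBound_axis {x : ℤ × ℤ} (hx : x ∈ axis) (h0 : maxNorm x ≠ 0) :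
    sojournBound x = 2 + 2 * maxNorm x := by
  rw [sojournBound, if_neg (axis_notMem_cone hx), if_neg (fun h => h0 (maxNorm_eq_zero_iff.2 h))]

theorem sojournBound_zero : sojournBound (0, 0) = 5 := by
  rw [sojournBound, if_neg zero_notMem_cone, if_pos rfl]

/-- The inward drift is close to `1`, so a slope of `2` pays for each unit of time. The intercept
`2` and the value `5` at the origin are fitted to the small distances: equality `1 + 4 = 5` at
distance `0`, and `15/4 ≤ 4` at distance `1`. -/
theorem sum_sojournBound_le {α : ℝ≥0} (hα : 3 < α) {x : ℤ × ℤ} (hx : x ∈ axis) :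
    1 + ∑ y ∈ neighbors x, transProb α x y * sojournBound y ≤ sojournBound x := by
  by_cases h0 : x = (0, 0)
  · subst h0
    have := sum_transProb_zero_le α (f := sojournBound) (b := 4) fun y hy h1 => by
      rw [sojournBound_axis hy (by omega), h1]; norm_num
    rw [sojournBound_zero]
    linarith
  · obtain ⟨a, b, c, d, ha, hb, hc, hd, hma, hmb, -, -, hsum⟩ := sum_transProb_axis hx h0
    have hpos := maxNorm_pos_of_ne h0
    have hr : (1 : ℝ) ≤ maxNorm x := by exact_mod_cast hpos
    have h3 := pow_three_le_rpow hα hr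
    rw [hsum, sojournBound_axis hx (by omega), sojournBound_axis hb (by omega),
      show sojournBound c = 0 by rw [sojournBound, if_pos hc],
      show sojournBound d = 0 by rw [sojournBound, if_pos hd], hmb]
    rcases hpos.eq_or_lt with h1 | h1
    · have ha0 : a = (0, 0) := maxNorm_eq_zero_iff.1 (by omega)
      rw [ha0, sojournBound_zero, ← h1]
      norm_num
    · rw [sojournBound_axis ha (by omega), hma]
      have hr2 : (2 : ℝ) ≤ maxNorm x := by exact_mod_cast h1
      set ε : ℝ := 1 / (4 * (maxNorm x : ℝ) ^ (α : ℝ)) with hε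
      have hε0 : 0 ≤ ε := by positivity
      have h4 : 3 / (4 * (maxNorm x : ℝ) ^ (α : ℝ)) = 3 * ε := by rw [hε]; ring
      rw [h4]
      push_cast
      nlinarith

open scoped Classical in
/-- A bound for the mean `ℓ¹` norm of the point at which the walk leaves the axis. -/
noncomputable def exitBound (x : ℤ × ℤ) : ℝ :=
  if x ∈ cone then taxiNorm x else if x = (0, 0) then 3 else 5 - 2 / maxNorm x

theorem exitBound_axis {x : ℤ × ℤ} (hx : x ∈ axis) (h0 : maxNorm x ≠ 0) :
    exitBound x = 5 - 2 / maxNorm x := by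
  rw [exitBound, if_neg (axis_notMem_cone hx), if_neg (fun h => h0 (maxNorm_eq_zero_iff.2 h))]

theorem exitBound_cone {x : ℤ × ℤ} (hx : x ∈ cone) : exitBound x = taxiNorm x := by
  rw [exitBound, if_pos hx]

theorem exitBound_zero : exitBound (0, 0) = 3 := by
  rw [exitBound, if_neg zero_notMem_cone, if_pos rfl]

theorem exitBound_axis_le {x : ℤ × ℤ} (hx : x ∈ axis) : exitBound x ≤ 5 := by
  by_cases h0 : x = (0, 0)
  · rw [h0, exitBound_zero]; norm_num
  · have hr : (1 : ℝ) ≤ maxNorm x := by exact_mod_cast maxNorm_pos_of_ne h0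
    rw [exitBound_axis hx (fun h => h0 (maxNorm_eq_zero_iff.1 h))]
    have : 0 ≤ 2 / (maxNorm x : ℝ) := by positivity
    linarith

theorem exitBound_nonneg (x : ℤ × ℤ) : 0 ≤ exitBound x := by
  by_cases hc : x ∈ cone
  · rw [exitBound_cone hc]; exact_mod_cast taxiNorm_nonneg x
  by_cases h0 : x = (0, 0)
  · rw [h0, exitBound_zero]; norm_num
  · have hr : (1 : ℝ) ≤ maxNorm x := by exact_mod_cast maxNorm_pos_of_ne h0
    rw [exitBound, if_neg hc, if_neg h0, sub_nonneg, div_le_iff₀ (by linarith)]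
    linarith

/-- A step from distance `i` leaves the axis with probability of order `i ^ (-α)` and then costs `i
+ 1`, a mean cost of order `i ^ (1 - α)`, which is at most of order `i ^ (-2)`. The inward step
lowers `5 - 2 / i` by `2 / (i (i - 1))`, which pays for it. The value `3` at the origin equals the
one at distance `1`. -/
theorem sum_exitBound_le {α : ℝ≥0} (hα : 3 < α) {x : ℤ × ℤ} (hx : x ∈ axis) :
    ∑ y ∈ neighbors x, transProb α x y * exitBound y ≤ exitBound x := by
  by_cases h0 : x = (0, 0)
  · subst h0
    rw [exitBound_zero]
    refine sum_transProb_zero_le α fun y hy h1 => ?_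
    rw [exitBound_axis hy (by omega), h1]; norm_num
  · obtain ⟨a, b, c, d, ha, hb, hc, hd, hma, hmb, htc, htd, hsum⟩ := sum_transProb_axis hx h0
    have hpos := maxNorm_pos_of_ne h0
    have hr : (1 : ℝ) ≤ maxNorm x := by exact_mod_cast hpos
    have h3 := pow_three_le_rpow hα hr
    rw [hsum, exitBound_axis hx (by omega), exitBound_axis hb (by omega),
      exitBound_cone hc, exitBound_cone hd, hmb, htc, htd]
    rcases hpos.eq_or_lt with h1 | h1
    · have ha0 : a = (0, 0) := maxNorm_eq_zero_iff.1 (by omega)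
      rw [ha0, exitBound_zero, ← h1]
      norm_num
    · rw [exitBound_axis ha (by omega), hma]
      have hr2 : (2 : ℝ) ≤ maxNorm x := by exact_mod_cast h1
      push_cast
      set i : ℝ := (maxNorm x : ℝ) with hi
      set ε : ℝ := 1 / (4 * i ^ (α : ℝ)) with hε
      have hε0 : 0 ≤ ε := by positivity
      have hε1 : ε ≤ 1 / (4 * i ^ 3) := by rw [hε]; gcongr
      have h4 : 3 / (4 * i ^ (α : ℝ)) = 3 * ε := by rw [hε]; ring
      rw [h4]
      have h5 : 0 ≤ 2 / (i + 1) := by positivity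
      have h6 : 2 / (i - 1) ≤ 2 := by rw [div_le_iff₀ (by linarith)]; linarith
      have h7 : 2 / (i - 1) - 2 / i = 2 / (i * (i - 1)) := by
        have : i - 1 ≠ 0 := by linarith
        field_simp
        ring
      have h8 : ε * (2 * i) ≤ 2 / (i * (i - 1)) := by
        calc ε * (2 * i) ≤ 1 / (4 * i ^ 3) * (2 * i) := by gcongr
          _ = 1 / (2 * (i * i)) := by field_simp; ring
          _ ≤ 1 / (i * (i - 1)) := by
            apply one_div_le_one_div_of_le
            · exact mul_pos (by linarith) (by linarith)
            · nlinarith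
          _ ≤ 2 / (i * (i - 1)) := by
            refine div_le_div_of_nonneg_right (by norm_num) ?_
            exact mul_nonneg (by linarith) (by linarith)
      -- With `ε` the probability of each non-inward step, the terms in `ε` have coefficient at most
      -- `2 * i`: the constants give `-15 + 5 + 2 = -8`, and `6 / (i - 1)` adds at most `6`.
      nlinarith

/-- The mean sojourn time on the axis grows at most linearly. -/
theorem meanRho_le {α : ℝ≥0} (hα : 3 < α) {x : ℤ × ℤ} (hx : x ∈ axis) :
    meanRho α x ≤ ENNReal.ofReal (sojournBound x) := by
  refine lintegral_le_of_superharmonic (A := cone) (c := 1)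
    (V := fun y => ENNReal.ofReal (sojournBound y)) ?_ ?_ ?_ (axis_notMem_cone hx)
  · intro y hy
    have hy' : y ∈ axis := not_not.1 hy
    rw [sum_stepProb_ofReal α y sojournBound_nonneg, ← ENNReal.ofReal_one,
      ← ENNReal.ofReal_add zero_le_one (Finset.sum_nonneg fun z _ =>
        mul_nonneg (transProb_nonneg α y z) (sojournBound_nonneg z))]
    exact ENNReal.ofReal_le_ofReal (sum_sojournBound_le hα hy')
  · intro ω hω
    rw [rho, hitAfter_zero_eq_hit hω, mul_one]
    exact le_self_add
  · intro ω _
    simp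

/-- From the axis, a finite mean of `ρ` excludes `ρ = ⊤`; other starting points reduce to this after
one step. -/
theorem walkLaw_avoiding_cone {α : ℝ≥0} (hα : 3 < α) (x : ℤ × ℤ) :
    walkLaw α x (avoiding cone) = 0 := by
  have haxis : ∀ y ∈ axis, walkLaw α y (avoiding cone) = 0 := by
    intro y hy
    have hfin : ∫⁻ ω, (rho ω : ℝ≥0∞) ∂(walkLaw α y) ≠ ⊤ :=
      ne_top_of_le_ne_top ENNReal.ofReal_ne_top (meanRho_le hα hy)
    have hm : Measurable fun ω => ((rho ω : ℕ∞) : ℝ≥0∞) :=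
      (Measurable.of_discrete (f := ((↑) : ℕ∞ → ℝ≥0∞))).comp
        (measurable_hitAfter cone measurable_const)
    rw [measure_eq_zero_iff_ae_notMem]
    filter_upwards [ae_lt_top hm hfin] with ω hω h
    rw [rho, hitAfter_eq_top fun k hk => h k (by exact_mod_cast hk)] at hω
    simp at hω
  rw [walkLaw_avoiding]
  refine Finset.sum_eq_zero fun y _ => ?_
  by_cases hy : y ∈ cone
  · rw [Set.indicator_of_notMem (by simpa using hy), mul_zero]
  · rw [Set.indicator_of_mem (by simpa using hy), haxis y (not_not.1 hy), mul_zero]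

/-! ### Almost sure regularity and the mean norm at exit and entrance -/

theorem ae_shiftPath {α : ℝ≥0} {s : Set (ℕ → ℤ × ℤ)} (hs : MeasurableSet s)
    (h : ∀ x, ∀ᵐ ω ∂(walkLaw α x), ω ∈ s) (n : ℕ) (x : ℤ × ℤ) :
    ∀ᵐ ω ∂(walkLaw α x), shiftPath n ω ∈ s := by
  have key := lintegral_markov α n x (G := fun _ => 1) (H := sᶜ.indicator 1) measurable_const
    (measurable_one.indicator hs.compl) (fun _ _ _ => rfl)
  have h0 : ∀ y, ∫⁻ ω, sᶜ.indicator 1 ω ∂(walkLaw α y) = 0 := fun y => by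
    rw [lintegral_indicator_one hs.compl]
    exact h y
  simp only [one_mul, h0, lintegral_zero] at key
  have hm : Measurable fun ω => sᶜ.indicator (1 : (ℕ → ℤ × ℤ) → ℝ≥0∞) (shiftPath n ω) :=
    (measurable_one.indicator hs.compl).comp (measurable_shiftPath n)
  rw [lintegral_eq_zero_iff hm] at key
  filter_upwards [key] with ω hω
  by_contra hns
  simp [Set.indicator_of_mem (show shiftPath n ω ∈ sᶜ from hns)] at hω

theorem ae_exists_hit {α : ℝ≥0} {A : Set (ℤ × ℤ)} (h : ∀ x, walkLaw α x (avoiding A) = 0)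
    (x : ℤ × ℤ) : ∀ᵐ ω ∂(walkLaw α x), ∀ n, ∃ k > n, ω k ∈ A := by
  rw [ae_all_iff]
  intro n
  filter_upwards [ae_shiftPath (measurableSet_avoiding A).compl
    (fun y => measure_eq_zero_iff_ae_notMem.1 (h y)) n x] with ω hω
  simp only [avoiding, Set.mem_compl_iff, Set.mem_ofPred_eq, not_forall, not_not] at hω
  obtain ⟨k, hk, hkA⟩ := hω
  exact ⟨n + k, by omega, hkA⟩

theorem zero_notMem_neighbors {x : ℤ × ℤ} (hx : x ∈ cone) : (0, 0) ∉ neighbors x := by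
  obtain ⟨h1, h2⟩ := cone_iff.1 hx
  simp only [neighbors, Finset.mem_insert, Finset.mem_singleton, Prod.mk.injEq]
  omega

theorem ae_not_cone_to_zero (α : ℝ≥0) (x : ℤ × ℤ) :
    ∀ᵐ ω ∂(walkLaw α x), ∀ n, ω n ∈ cone → ω (n + 1) ≠ (0, 0) := by
  have hs : MeasurableSet {ω : ℕ → ℤ × ℤ | ω 0 ∈ cone ∧ ω 1 = (0, 0)} :=
    ((measurable_pi_apply (X := fun _ : ℕ => ℤ × ℤ) 0)
      (MeasurableSet.of_discrete (s := cone))).inter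
      ((measurable_pi_apply (X := fun _ : ℕ => ℤ × ℤ) 1)
      (measurableSet_singleton ((0, 0) : ℤ × ℤ)))
  have h : ∀ y, ∀ᵐ ω ∂(walkLaw α y), ω ∈ {ω : ℕ → ℤ × ℤ | ω 0 ∈ cone ∧ ω 1 = (0, 0)}ᶜ := by
    intro y
    refine measure_eq_zero_iff_ae_notMem.1 ?_
    rw [walkLaw_step α y hs]
    refine Finset.sum_eq_zero fun z hz => ?_
    rw [mul_eq_zero]
    right
    rw [measure_eq_zero_iff_ae_notMem]
    filter_upwards [ae_start α z] with ω hω hmem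
    obtain ⟨h1, h2⟩ := hmem
    simp only [consPath_zero] at h1
    have h3 : ω 0 = (0, 0) := h2
    exact zero_notMem_neighbors h1 (by rw [← h3, hω]; exact hz)
  rw [ae_all_iff]
  intro n
  filter_upwards [ae_shiftPath hs.compl h n x] with ω hω h1 h2
  exact hω ⟨h1, h2⟩

theorem ae_isRegular {α : ℝ≥0} (hα : 3 < α) (x : ℤ × ℤ) : ∀ᵐ ω ∂(walkLaw α x), IsRegular ω := by
  filter_upwards [ae_exists_hit (walkLaw_avoiding_axis α) x,
    ae_exists_hit (walkLaw_avoiding_cone hα) x, ae_not_cone_to_zero α x] with ω h1 h2 h3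
  exact ⟨h1, h2, h3⟩

/-- The mean `ℓ¹` norm of the point at which the walk leaves the axis is bounded. -/
theorem lintegral_taxiNorm_exit_le {α : ℝ≥0} (hα : 3 < α) {x : ℤ × ℤ} (hx : x ∈ axis) :
    ∫⁻ ω, ENNReal.ofReal (taxiNorm (ω (hit cone ω))) ∂(walkLaw α x) ≤ 5 := by
  -- With zero cost the functional has to vanish on trajectories that never hit the cones, where
  -- `hit` has the default value `0`; the indicator removes this null set.
  have h := lintegral_le_of_superharmonic (α := α) (A := cone) (c := 0)
    (V := fun y => ENNReal.ofReal (exitBound y))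
    (Φ := (avoiding cone)ᶜ.indicator fun ω => ENNReal.ofReal (taxiNorm (ω (hit cone ω))))
    ?_ ?_ ?_ (axis_notMem_cone hx)
  · calc ∫⁻ ω, ENNReal.ofReal (taxiNorm (ω (hit cone ω))) ∂(walkLaw α x)
        = ∫⁻ ω, (avoiding cone)ᶜ.indicator
            (fun ω => ENNReal.ofReal (taxiNorm (ω (hit cone ω)))) ω ∂(walkLaw α x) := by
          refine lintegral_congr_ae ?_
          filter_upwards [measure_eq_zero_iff_ae_notMem.1 (walkLaw_avoiding_cone hα x)] with ω hω
          rw [Set.indicator_of_mem (show ω ∈ (avoiding cone)ᶜ from hω)]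
      _ ≤ ENNReal.ofReal (exitBound x) := h
      _ ≤ ENNReal.ofReal 5 := ENNReal.ofReal_le_ofReal (exitBound_axis_le hx)
      _ = 5 := by norm_num
  · intro y hy
    rw [zero_add, sum_stepProb_ofReal α y exitBound_nonneg]
    exact ENNReal.ofReal_le_ofReal (sum_exitBound_le hα (not_not.1 hy))
  · intro ω hω
    refine (Set.indicator_le_self _ _ ω).trans ?_
    rw [exitBound_cone (hit_spec hω).2.1]
    exact le_add_self
  · intro ω hω
    rw [Set.indicator_of_notMem]
    · simp
    · simpa [avoiding] using hω

/-- The mean `ℓ¹` norm of the point at which the walk leaves a cone. -/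
theorem lintegral_taxiNorm_entrance_le (α : ℝ≥0) {x : ℤ × ℤ} (hx : x ∈ cone) :
    ∫⁻ ω, ENNReal.ofReal (taxiNorm (ω (hit axis ω))) ∂(walkLaw α x) ≤
      ENNReal.ofReal (taxiNorm x) := by
  have h := lintegral_le_of_superharmonic (α := α) (A := axis) (c := 0)
    (V := fun y => ENNReal.ofReal (taxiNorm y))
    (Φ := (avoiding axis)ᶜ.indicator fun ω => ENNReal.ofReal (taxiNorm (ω (hit axis ω))))
    ?_ ?_ ?_ hx
  · refine le_of_eq_of_le (lintegral_congr_ae ?_) h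
    filter_upwards [measure_eq_zero_iff_ae_notMem.1 (walkLaw_avoiding_axis α x)] with ω hω
    rw [Set.indicator_of_mem (show ω ∈ (avoiding axis)ᶜ from hω)]
  · intro y hy
    have ht : (taxiNorm (y.1 + 1, y.2) : ℝ) + taxiNorm (y.1 - 1, y.2) + taxiNorm (y.1, y.2 + 1) +
      taxiNorm (y.1, y.2 - 1) = 4 * taxiNorm y := by exact_mod_cast sum_taxiNorm hy
    rw [zero_add, sum_stepProb_ofReal α y fun z => by exact_mod_cast taxiNorm_nonneg z,
      sum_transProb_uniform α (Or.inl hy) fun z => (taxiNorm z : ℝ), ht]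
    exact ENNReal.ofReal_le_ofReal (by linarith)
  · intro ω hω
    exact (Set.indicator_le_self _ _ ω).trans le_add_self
  · intro ω hω
    rw [Set.indicator_of_notMem]
    · simp
    · simpa [avoiding] using hω

/-! ### Doeblin chains on an abstract state space -/

section Doeblin

open scoped Classical in
/-- The part of the transition matrix `Q` that is left after removing mass `c` at `x₀` from every
row. -/
noncomputable def residual {Y : Type*} (Q : Y → Y → ℝ≥0∞) (x₀ : Y) (c : ℝ≥0∞) (y x : Y) : ℝ≥0∞ :=
  Q y x - (if x = x₀ then c else 0)

open scoped Classical in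
/-- The law after `k` steps of the residual chain started from `x₀`. -/
noncomputable def residualLaw {Y : Type*} (Q : Y → Y → ℝ≥0∞) (x₀ : Y) (c : ℝ≥0∞) :
    ℕ → Y → ℝ≥0∞
  | 0, x => if x = x₀ then 1 else 0
  | k + 1, x => ∑' y, residualLaw Q x₀ c k y * residual Q x₀ c y x

/-- The invariant law of a transition matrix all of whose rows are at least `c` at `x₀`. -/
noncomputable def doeblinLaw {Y : Type*} (Q : Y → Y → ℝ≥0∞) (x₀ : Y) (c : ℝ≥0∞) (x : Y) : ℝ≥0∞ :=
  c * ∑' k, residualLaw Q x₀ c k x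

variable {Y : Type*} {Q : Y → Y → ℝ≥0∞} {x₀ : Y} {c : ℝ≥0∞}

open scoped Classical in
theorem residual_add (hD : ∀ y, c ≤ Q y x₀) (y x : Y) :
    residual Q x₀ c y x + (if x = x₀ then c else 0) = Q y x := by
  unfold residual
  refine tsub_add_cancel_of_le ?_
  split_ifs with h
  · rw [h]; exact hD y
  · exact zero_le

theorem doeblin_const_le_one (hQ : ∀ y, ∑' x, Q y x = 1) (hD : ∀ y, c ≤ Q y x₀) : c ≤ 1 :=
  (hD x₀).trans ((ENNReal.le_tsum x₀).trans (hQ x₀).le)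

theorem tsum_residual (hQ : ∀ y, ∑' x, Q y x = 1) (hD : ∀ y, c ≤ Q y x₀) (y : Y) :
    ∑' x, residual Q x₀ c y x = 1 - c := by
  classical
  refine ENNReal.eq_sub_of_add_eq
    (ne_top_of_le_ne_top ENNReal.one_ne_top (doeblin_const_le_one hQ hD)) ?_
  calc ∑' x, residual Q x₀ c y x + c
      = ∑' x, residual Q x₀ c y x + ∑' x, (if x = x₀ then c else 0) := by
        rw [tsum_ite_eq x₀ fun _ => c]
    _ = ∑' x, Q y x := by
        rw [← ENNReal.tsum_add]
        exact tsum_congr fun x => residual_add hD y x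
    _ = 1 := hQ y

theorem tsum_mul_eq (hD : ∀ y, c ≤ Q y x₀) (y : Y) (g : Y → ℝ≥0∞) :
    ∑' x, Q y x * g x = ∑' x, residual Q x₀ c y x * g x + c * g x₀ := by
  classical
  rw [← tsum_ite_eq x₀ (fun x => c * g x), ← ENNReal.tsum_add]
  refine tsum_congr fun x => ?_
  rw [← residual_add hD y x, add_mul]
  split_ifs <;> simp

/-- On probability vectors, `p Q = p R + c δ` with `R` the residual matrix and `δ` the unit mass at
`x₀`. -/
theorem tsum_left_mul_eq (hD : ∀ y, c ≤ Q y x₀) (p : Y → ℝ≥0∞) (hp : ∑' y, p y = 1) (x : Y) :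
    ∑' y, p y * Q y x = ∑' y, p y * residual Q x₀ c y x + c * residualLaw Q x₀ c 0 x := by
  classical
  have : c * residualLaw Q x₀ c 0 x = ∑' y, p y * (if x = x₀ then c else 0) := by
    rw [ENNReal.tsum_mul_right, hp, residualLaw]
    split_ifs <;> simp
  rw [this, ← ENNReal.tsum_add]
  refine tsum_congr fun y => ?_
  rw [← mul_add, residual_add hD]

theorem tsum_residualLaw (hQ : ∀ y, ∑' x, Q y x = 1) (hD : ∀ y, c ≤ Q y x₀) (k : ℕ) :
    ∑' x, residualLaw Q x₀ c k x = (1 - c) ^ k := by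
  classical
  induction k with
  | zero => simp [residualLaw]
  | succ k ih =>
    simp only [residualLaw]
    rw [ENNReal.tsum_comm]
    simp only [ENNReal.tsum_mul_left, tsum_residual hQ hD]
    rw [ENNReal.tsum_mul_right, ih, pow_succ]

theorem tsum_doeblinLaw (hQ : ∀ y, ∑' x, Q y x = 1) (hD : ∀ y, c ≤ Q y x₀) (hc : c ≠ 0) :
    ∑' x, doeblinLaw Q x₀ c x = 1 := by
  have h1 := doeblin_const_le_one hQ hD
  simp only [doeblinLaw]
  rw [ENNReal.tsum_mul_left, ENNReal.tsum_comm]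
  simp only [tsum_residualLaw hQ hD]
  rw [ENNReal.tsum_geometric, ENNReal.sub_sub_cancel ENNReal.one_ne_top h1]
  exact ENNReal.mul_inv_cancel hc (ne_top_of_le_ne_top ENNReal.one_ne_top h1)

/-- The series `c ∑ δ R ^ k` is a fixed point of `p ↦ p R + c δ`: `R` shifts it by one term and `c
δ` restores the first. -/
theorem doeblinLaw_invariant (hQ : ∀ y, ∑' x, Q y x = 1) (hD : ∀ y, c ≤ Q y x₀) (hc : c ≠ 0)
    (x : Y) : ∑' y, doeblinLaw Q x₀ c y * Q y x = doeblinLaw Q x₀ c x := by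
  rw [tsum_left_mul_eq hD _ (tsum_doeblinLaw hQ hD hc)]
  simp only [doeblinLaw]
  rw [tsum_eq_zero_add' (f := fun k => residualLaw Q x₀ c k x) ENNReal.summable, mul_add,
    add_comm]
  congr 1
  simp only [mul_assoc]
  rw [ENNReal.tsum_mul_left]
  congr 1
  simp only [residualLaw, ← ENNReal.tsum_mul_right]
  exact ENNReal.tsum_comm

/-- Iterating `p = p R + c δ` shows that `p` dominates every partial sum of the series, hence the
series; both have total mass one, so they coincide. -/
theorem eq_doeblinLaw (hQ : ∀ y, ∑' x, Q y x = 1) (hD : ∀ y, c ≤ Q y x₀) (hc : c ≠ 0)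
    {p : Y → ℝ≥0∞} (hp : ∑' y, p y = 1) (hinv : ∀ x, ∑' y, p y * Q y x = p x) :
    p = doeblinLaw Q x₀ c := by
  have hle : ∀ (n : ℕ) (x : Y), c * ∑ k ∈ Finset.range n, residualLaw Q x₀ c k x ≤ p x := by
    intro n
    induction n with
    | zero => intro x; simp
    | succ n ih =>
      intro x
      rw [← hinv x, tsum_left_mul_eq hD p hp, Finset.sum_range_succ', mul_add]
      gcongr
      calc c * ∑ k ∈ Finset.range n, residualLaw Q x₀ c (k + 1) x
          = ∑' y, (c * ∑ k ∈ Finset.range n, residualLaw Q x₀ c k y) * residual Q x₀ c y x := by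
            simp only [residualLaw, mul_assoc, ENNReal.tsum_mul_left, Finset.sum_mul]
            rw [Summable.tsum_finsetSum fun _ _ => ENNReal.summable]
        _ ≤ ∑' y, p y * residual Q x₀ c y x := ENNReal.tsum_le_tsum fun y => by gcongr; exact ih y
  have hle' : ∀ x, doeblinLaw Q x₀ c x ≤ p x := by
    intro x
    rw [doeblinLaw, ENNReal.tsum_eq_iSup_nat, ENNReal.mul_iSup]
    exact iSup_le fun n => hle n x
  funext x
  by_contra hne
  have hlt : doeblinLaw Q x₀ c x < p x := lt_of_le_of_ne (hle' x) (Ne.symm hne)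
  have hfin : ∑' x, doeblinLaw Q x₀ c x ≠ ⊤ := by
    rw [tsum_doeblinLaw hQ hD hc]; exact ENNReal.one_ne_top
  have := ENNReal.tsum_lt_tsum hfin hle' hlt
  rw [tsum_doeblinLaw hQ hD hc, hp] at this
  exact lt_irrefl _ this

/-- One step of the chain contracts oscillations by the factor `1 - c`. -/
theorem exists_oscillation_le (hQ : ∀ y, ∑' x, Q y x = 1) (hD : ∀ y, c ≤ Q y x₀)
    {g : Y → ℝ≥0∞} {a d : ℝ≥0∞} (h : ∀ y, a ≤ g y ∧ g y ≤ a + d) :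
    ∃ a', ∀ y, a' ≤ ∑' x, Q y x * g x ∧ ∑' x, Q y x * g x ≤ a' + (1 - c) * d := by
  -- The mass `c` at `x₀` is common to all rows and contributes the same `c * g x₀`; only the
  -- residual mass `1 - c` sees the oscillation of `g`.
  refine ⟨(1 - c) * a + c * g x₀, fun y => ?_⟩
  rw [tsum_mul_eq hD y g, ← tsum_residual hQ hD y]
  constructor
  · gcongr
    rw [← ENNReal.tsum_mul_right]
    exact ENNReal.tsum_le_tsum fun x => by gcongr; exact (h x).1
  · rw [add_right_comm, ← mul_add]
    gcongr
    rw [← ENNReal.tsum_mul_right]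
    exact ENNReal.tsum_le_tsum fun x => by gcongr; exact (h x).2

end Doeblin

/-! ### Strong Markov property and the chain of return points -/

theorem hitAfter_congr {A : Set (ℤ × ℤ)} {T : ℕ∞} {n : ℕ} {ω ω' : ℕ → ℤ × ℤ}
    (h : ∀ i ≤ n, ω i = ω' i) (hn : hitAfter A T ω = n) : hitAfter A T ω' = n := by
  rw [hitAfter_eq_coe_iff] at hn ⊢
  exact ⟨hn.1, h n le_rfl ▸ hn.2.1, fun k hk hkn => h k hkn.le ▸ hn.2.2 k hk hkn⟩

/-- Sum over the values of `N`: by `hloc`, the restriction of `F` to `{N = n}` depends only on the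
trajectory up to `n`, so the Markov property at the fixed time `n` applies. -/
theorem lintegral_strong_markov {α : ℝ≥0} {x : ℤ × ℤ} {N : (ℕ → ℤ × ℤ) → ℕ∞}
    {F H : (ℕ → ℤ × ℤ) → ℝ≥0∞} (hN : Measurable N) (hF : Measurable F) (hH : Measurable H)
    (hloc : ∀ (n : ℕ) (ω ω' : ℕ → ℤ × ℤ), (∀ i ≤ n, ω i = ω' i) → N ω = n →
      N ω' = n ∧ F ω = F ω')
    (hfin : ∀ᵐ ω ∂(walkLaw α x), N ω ≠ ⊤) :
    ∫⁻ ω, F ω * H (shiftPath (N ω).toNat ω) ∂(walkLaw α x) =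
      ∫⁻ ω, F ω * ∫⁻ ω', H ω' ∂(walkLaw α (ω (N ω).toNat)) ∂(walkLaw α x) := by
  classical
  set G : ℕ → (ℕ → ℤ × ℤ) → ℝ≥0∞ := fun n => {ω | N ω = n}.indicator F with hG
  have hGm : ∀ n, Measurable (G n) := fun n => hF.indicator (hN (measurableSet_singleton _))
  have hsplit : ∀ K : ℕ → (ℕ → ℤ × ℤ) → ℝ≥0∞, (∀ n, Measurable (K n)) →
      ∫⁻ ω, F ω * K (N ω).toNat ω ∂(walkLaw α x) = ∑' n, ∫⁻ ω, G n ω * K n ω ∂(walkLaw α x) := by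
    intro K hK
    have hGK : ∀ n, AEMeasurable (fun ω => G n ω * K n ω) (walkLaw α x) := fun n =>
      ((hGm n).mul (hK n)).aemeasurable
    rw [← lintegral_tsum hGK]
    refine lintegral_congr_ae ?_
    filter_upwards [hfin] with ω hω
    obtain ⟨n, hn⟩ := ENat.ne_top_iff_exists.1 hω
    rw [tsum_eq_single n]
    · simp [hG, ← hn]
    · intro m hm
      have : N ω ≠ m := by
        rw [← hn]; exact_mod_cast Ne.symm hm
      simp [hG, this]
  rw [hsplit (fun n ω => H (shiftPath n ω)) fun n => hH.comp (measurable_shiftPath n),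
    hsplit (fun n ω => ∫⁻ ω', H ω' ∂(walkLaw α (ω n)))
      fun n => measurable_lintegral_walkLaw α H n]
  refine tsum_congr fun n => lintegral_markov α n x (hGm n) hH fun ω ω' h => ?_
  by_cases hω : N ω = n
  · obtain ⟨h1, h2⟩ := hloc n ω ω' h hω
    simp [hG, hω, h1, h2]
  · have hω' : N ω' ≠ n := fun h' => hω (hloc n ω' ω (fun i hi => (h i hi).symm) h').1
    simp [hG, hω, hω']

/-- The first return time to the axis after a visit of the cones. -/
noncomputable def returnTime (ω : ℕ → ℤ × ℤ) : ℕ∞ := hitAfter axis (rho ω) ω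

theorem measurable_rho : Measurable rho := measurable_hitAfter cone measurable_const

theorem measurable_returnTime : Measurable returnTime := measurable_hitAfter axis measurable_rho

theorem IsRegular.rho_eq {ω : ℕ → ℤ × ℤ} (h : IsRegular ω) : rho ω = hit cone ω :=
  hitAfter_zero_eq_hit (h.2.1 0)

theorem IsRegular.returnTime_eq {ω : ℕ → ℤ × ℤ} (h : IsRegular ω) :
    returnTime ω = ((hit cone ω + hit axis (AxisWalk.shiftPath (hit cone ω) ω) : ℕ) : ℕ∞) := by
  rw [returnTime, h.rho_eq]
  exact hitAfter_coe_eq_hit (h.1 _)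

theorem IsRegular.returnTime_ne_top {ω : ℕ → ℤ × ℤ} (h : IsRegular ω) : returnTime ω ≠ ⊤ := by
  rw [h.returnTime_eq]; exact ENat.natCast_ne_top _

theorem returnTime_congr {n : ℕ} {ω ω' : ℕ → ℤ × ℤ} (h : ∀ i ≤ n, ω i = ω' i)
    (hn : returnTime ω = n) : returnTime ω' = n ∧ ∃ m ≤ n, rho ω = m := by
  have h1 := hitAfter_eq_coe_iff.1 hn
  obtain ⟨m, hm⟩ := ENat.ne_top_iff_exists.1 (ne_top_of_lt h1.1)
  have hmn : m < n := by
    have := h1.1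
    rw [← hm] at this
    exact_mod_cast this
  have h2 : rho ω' = m := hitAfter_congr (fun i hi => h i (hi.trans hmn.le)) hm.symm
  refine ⟨?_, m, hmn.le, hm.symm⟩
  rw [returnTime, h2, hm]
  exact hitAfter_congr h hn

/-- The trajectory after its first return to the axis. -/
noncomputable def returnShift (ω : ℕ → ℤ × ℤ) : ℕ → ℤ × ℤ := shiftPath (returnTime ω).toNat ω

theorem measurable_returnTime_toNat : Measurable fun ω => (returnTime ω).toNat :=
  (Measurable.of_discrete (f := ENat.toNat)).comp measurable_returnTime

theorem measurable_returnShift : Measurable returnShift :=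
  measurable_shiftPath_time measurable_returnTime_toNat

/-- A functional of the trajectory that is determined by the trajectory up to time `ρ`. -/
def IsSojournFunctional {β : Type*} (F : (ℕ → ℤ × ℤ) → β) : Prop :=
  ∀ (n : ℕ) (ω ω' : ℕ → ℤ × ℤ), (∀ i ≤ n, ω i = ω' i) → rho ω = n → F ω = F ω'

/-- Strong Markov property at the return time; a sojourn functional is already settled at `ρ`, which
comes earlier. -/
theorem lintegral_mul_returnShift {α : ℝ≥0} (hα : 3 < α) (x : ℤ × ℤ)
    {F H : (ℕ → ℤ × ℤ) → ℝ≥0∞} (hF : Measurable F) (hFs : IsSojournFunctional F)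
    (hH : Measurable H) :
    ∫⁻ ω, F ω * H (returnShift ω) ∂(walkLaw α x) =
      ∫⁻ ω, F ω * ∫⁻ ω', H ω' ∂(walkLaw α (ω (returnTime ω).toNat)) ∂(walkLaw α x) := by
  refine lintegral_strong_markov measurable_returnTime hF hH ?_ ?_
  · intro n ω ω' h hn
    obtain ⟨h1, m, hmn, hm⟩ := returnTime_congr h hn
    exact ⟨h1, hFs m ω ω' (fun i hi => h i (hi.trans hmn)) hm⟩
  · filter_upwards [ae_isRegular hα x] with ω hω
    exact hω.returnTime_ne_top

theorem IsRegular.returnTime_mem {ω : ℕ → ℤ × ℤ} (h : IsRegular ω) :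
    ω (returnTime ω).toNat ∈ axis := by
  obtain ⟨n, hn⟩ := ENat.ne_top_iff_exists.1 h.returnTime_ne_top
  rw [← hn]
  exact (hitAfter_eq_coe_iff.1 hn.symm).2.1

theorem returnProb_eq {α : ℝ≥0} (hα : 3 < α) (y x : axis) :
    returnProb α y x = walkLaw α y {ω | ω (returnTime ω).toNat = x} := by
  refine measure_congr ?_
  filter_upwards [ae_isRegular hα y] with ω hω
  obtain ⟨n, hn⟩ := ENat.ne_top_iff_exists.1 hω.returnTime_ne_top
  refine propext ⟨?_, fun h => ⟨n, hn.symm, ?_⟩⟩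
  · rintro ⟨m, hm, hmx⟩
    change ω (returnTime ω).toNat = x
    rw [returnTime, hm]
    exact hmx
  · have h' : ω (returnTime ω).toNat = x := h
    rw [← hn] at h'
    exact h'

theorem lintegral_return {α : ℝ≥0} (hα : 3 < α) (y : axis) (h : ℤ × ℤ → ℝ≥0∞) :
    ∫⁻ ω, h (ω (returnTime ω).toNat) ∂(walkLaw α y) = ∑' x : axis, returnProb α y x * h x := by
  classical
  have hZ : Measurable fun ω : ℕ → ℤ × ℤ => ω (returnTime ω).toNat :=
    measurable_apply_time measurable_returnTime_toNat
  have hs : ∀ x : axis, MeasurableSet {ω : ℕ → ℤ × ℤ | ω (returnTime ω).toNat = x} := fun x =>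
    hZ (measurableSet_singleton (x : ℤ × ℤ))
  calc ∫⁻ ω, h (ω (returnTime ω).toNat) ∂(walkLaw α y)
      = ∫⁻ ω, ∑' x : axis, {ω : ℕ → ℤ × ℤ | ω (returnTime ω).toNat = x}.indicator
          (fun _ => h x) ω ∂(walkLaw α y) := by
        refine lintegral_congr_ae ?_
        filter_upwards [ae_isRegular hα y] with ω hω
        rw [tsum_eq_single (⟨_, hω.returnTime_mem⟩ : axis)]
        · simp
        · intro x hx
          refine Set.indicator_of_notMem (fun hmem => hx ?_) _
          exact Subtype.ext (Eq.symm hmem)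
    _ = ∑' x : axis, returnProb α y x * h x := by
        rw [lintegral_tsum fun x => (measurable_const.indicator (hs x)).aemeasurable]
        refine tsum_congr fun x => ?_
        rw [lintegral_indicator_const (hs x), returnProb_eq hα, mul_comm]

theorem tsum_returnProb {α : ℝ≥0} (hα : 3 < α) (y : axis) : ∑' x : axis, returnProb α y x = 1 := by
  have := lintegral_return hα y fun _ => 1
  simp only [lintegral_const, measure_univ, mul_one] at this
  exact this.symm

/-! ### Doeblin's condition: returning to the axis at `(1, 0)` -/

theorem hitAfter_consPath {A : Set (ℤ × ℤ)} (T : ℕ∞) (x : ℤ × ℤ) (ω : ℕ → ℤ × ℤ) :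
    hitAfter A (1 + T) (consPath x ω) = 1 + hitAfter A T ω := by
  have := hitAfter_add (A := A) 1 T (consPath x ω)
  rwa [shiftPath_succ_consPath 0, shiftPath_zero] at this

/-- `ρ` ignores time `0`, but `ω 0` is at time `1` of the prolonged trajectory; if it lies on the
axis it does not stop the search. -/
theorem rho_consPath_of_axis (x : ℤ × ℤ) {ω : ℕ → ℤ × ℤ} (h : ω 0 ∈ axis) :
    rho (consPath x ω) = 1 + rho ω := by
  rw [rho, rho, ← hitAfter_consPath, add_zero]
  unfold hitAfter
  congr 2
  ext k
  simp only [Set.mem_ofPred_eq, Nat.cast_pos, Nat.one_lt_cast]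
  refine ⟨fun ⟨h1, h2⟩ => ⟨?_, h2⟩, fun ⟨h1, h2⟩ => ⟨by omega, h2⟩⟩
  by_contra hk
  obtain rfl : k = 1 := by omega
  exact h2 h

theorem rho_consPath_of_cone (x : ℤ × ℤ) {ω : ℕ → ℤ × ℤ} (h : ω 0 ∈ cone) :
    rho (consPath x ω) = 1 :=
  hitAfter_eq_coe (n := 1) (by simp) h fun k hk hk1 => by
    have : 0 < k := by exact_mod_cast hk
    omega

theorem returnTime_consPath_of_axis (x : ℤ × ℤ) {ω : ℕ → ℤ × ℤ} (h : ω 0 ∈ axis) :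
    returnTime (consPath x ω) = 1 + returnTime ω := by
  rw [returnTime, rho_consPath_of_axis x h, hitAfter_consPath, returnTime]

theorem returnTime_consPath_of_cone (x : ℤ × ℤ) {ω : ℕ → ℤ × ℤ} (h : ω 0 ∈ cone) :
    returnTime (consPath x ω) = 1 + hitAfter axis 0 ω := by
  rw [returnTime, rho_consPath_of_cone x h, ← hitAfter_consPath, add_zero]

/-- The trajectories that return to the axis at `z`. -/
def returnsAt (z : ℤ × ℤ) : Set (ℕ → ℤ × ℤ) := {ω | ∃ n : ℕ, returnTime ω = n ∧ ω n = z}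

/-- The trajectories that enter the axis at `z`. -/
def entersAt (z : ℤ × ℤ) : Set (ℕ → ℤ × ℤ) := {ω | ∃ n : ℕ, hitAfter axis 0 ω = n ∧ ω n = z}

theorem measurableSet_exists_time {N : (ℕ → ℤ × ℤ) → ℕ∞} (hN : Measurable N) (z : ℤ × ℤ) :
    MeasurableSet {ω : ℕ → ℤ × ℤ | ∃ n : ℕ, N ω = n ∧ ω n = z} := by
  have : {ω : ℕ → ℤ × ℤ | ∃ n : ℕ, N ω = n ∧ ω n = z} =
      ⋃ n : ℕ, {ω | N ω = n} ∩ {ω : ℕ → ℤ × ℤ | ω n = z} := by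
    ext ω; simp
  rw [this]
  exact MeasurableSet.iUnion fun n => (hN (measurableSet_singleton _)).inter
    ((measurable_pi_apply (X := fun _ : ℕ => ℤ × ℤ) n) (measurableSet_singleton z))

theorem measurableSet_returnsAt (z : ℤ × ℤ) : MeasurableSet (returnsAt z) :=
  measurableSet_exists_time measurable_returnTime z

theorem measurableSet_entersAt (z : ℤ × ℤ) : MeasurableSet (entersAt z) :=
  measurableSet_exists_time (measurable_hitAfter axis measurable_const) z

theorem real_walkLaw_step (α : ℝ≥0) (x : ℤ × ℤ) {s : Set (ℕ → ℤ × ℤ)} (hs : MeasurableSet s) :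
    (walkLaw α x).real s =
      ∑ y ∈ neighbors x, transProb α x y * (walkLaw α y).real (consPath x ⁻¹' s) := by
  rw [measureReal_def, walkLaw_step α x hs, ENNReal.toReal_sum]
  · refine Finset.sum_congr rfl fun y _ => ?_
    rw [ENNReal.toReal_mul, stepProb, ENNReal.toReal_ofReal (transProb_nonneg α x y),
      measureReal_def]
  · intro y _
    exact ENNReal.mul_ne_top ENNReal.ofReal_ne_top (measure_ne_top _ _)

theorem transProb_mul_le_real_walkLaw (α : ℝ≥0) {x y : ℤ × ℤ} (hy : y ∈ neighbors x)
    {s t : Set (ℕ → ℤ × ℤ)} (hs : MeasurableSet s)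
    (h : ∀ ω ∈ t, ω 0 = y → consPath x ω ∈ s) :
    transProb α x y * (walkLaw α y).real t ≤ (walkLaw α x).real s := by
  rw [real_walkLaw_step α x hs]
  refine le_trans ?_ (Finset.single_le_sum (f := fun y =>
    transProb α x y * (walkLaw α y).real (consPath x ⁻¹' s))
    (fun z _ => mul_nonneg (transProb_nonneg α x z) measureReal_nonneg) hy)
  refine mul_le_mul_of_nonneg_left ?_ (transProb_nonneg α x y)
  refine ENNReal.toReal_mono (measure_ne_top _ _) (measure_mono_ae ?_)
  filter_upwards [ae_start α y] with ω hω hmem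
  exact h ω hmem hω

theorem consPath_mem_returnsAt_of_axis {x z : ℤ × ℤ} {ω : ℕ → ℤ × ℤ} (h0 : ω 0 ∈ axis)
    (h : ω ∈ returnsAt z) : consPath x ω ∈ returnsAt z := by
  obtain ⟨n, hn, hz⟩ := h
  refine ⟨n + 1, ?_, hz⟩
  rw [returnTime_consPath_of_axis x h0, hn]
  push_cast
  exact add_comm _ _

theorem consPath_mem_returnsAt_of_cone {x z : ℤ × ℤ} {ω : ℕ → ℤ × ℤ} (h0 : ω 0 ∈ cone)
    (h : ω ∈ entersAt z) : consPath x ω ∈ returnsAt z := by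
  obtain ⟨n, hn, hz⟩ := h
  refine ⟨n + 1, ?_, hz⟩
  rw [returnTime_consPath_of_cone x h0, hn]
  push_cast
  exact add_comm _ _

theorem one_zero_mem_axis : ((1, 0) : ℤ × ℤ) ∈ axis := by simp [axis_iff]

theorem one_one_mem_cone : ((1, 1) : ℤ × ℤ) ∈ cone := by simp [cone_iff]

theorem transProb_one_zero (α : ℝ≥0) : transProb α (1, 0) (1, 1) = 1 / 4 := by
  simp [transProb, neighbors, maxNorm]

theorem le_real_entersAt (α : ℝ≥0) : 1 / 4 ≤ (walkLaw α (1, 1)).real (entersAt (1, 0)) := by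
  have hmem : ∀ ω : ℕ → ℤ × ℤ, ω 0 = (1, 0) → consPath (1, 1) ω ∈ entersAt (1, 0) := by
    intro ω h0
    refine ⟨1, hitAfter_eq_coe (by simp) ?_ fun k hk hk1 => ?_, h0⟩
    · change ω 0 ∈ axis
      rw [h0]; exact one_zero_mem_axis
    · have : 0 < k := by exact_mod_cast hk
      omega
  have h := transProb_mul_le_real_walkLaw α (x := (1, 1)) (y := (1, 0)) (by simp [neighbors])
    (t := Set.univ) (measurableSet_entersAt (1, 0)) fun ω _ h0 => hmem ω h0
  rw [transProb_of_uniform (Or.inl one_one_mem_cone) (by simp [neighbors])] at h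
  simpa using h

theorem le_real_returnsAt_one_zero (α : ℝ≥0) :
    1 / 16 ≤ (walkLaw α (1, 0)).real (returnsAt (1, 0)) := by
  have h := transProb_mul_le_real_walkLaw α (x := (1, 0)) (y := (1, 1)) (by simp [neighbors])
    (measurableSet_returnsAt (1, 0))
    fun ω hω h0 => consPath_mem_returnsAt_of_cone (by rw [h0]; exact one_one_mem_cone) hω
  rw [transProb_one_zero] at h
  refine le_trans ?_ h
  linarith [le_real_entersAt α]

theorem le_real_returnsAt_zero (α : ℝ≥0) :
    1 / 64 ≤ (walkLaw α (0, 0)).real (returnsAt (1, 0)) := by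
  have h := transProb_mul_le_real_walkLaw α (x := (0, 0)) (y := (1, 0)) (by simp [neighbors])
    (measurableSet_returnsAt (1, 0))
    fun ω hω h0 => consPath_mem_returnsAt_of_axis (by rw [h0]; exact one_zero_mem_axis) hω
  rw [transProb_of_uniform (Or.inr rfl) (by simp [neighbors])] at h
  refine le_trans ?_ h
  linarith [le_real_returnsAt_one_zero α]

/-- Only the inward step is kept. The factor `1 + 1 / i` makes the induction close, because `(1 - 1
/ i ^ 2) (1 + 1 / (i - 1)) = 1 + 1 / i` and the loss `3 / (4 i ^ α)` is at most `1 / i ^ 2`. At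
distance one the inward step has probability `1/4`, so the bound `1/64` at the origin becomes `1/256
= 2/512`. -/
theorem le_real_returnsAt_of_pos {α : ℝ≥0} (hα : 3 < α) (n : ℕ) :
    ∀ x ∈ axis, maxNorm x = n + 1 →
      1 / 512 * (1 + 1 / ((n : ℝ) + 1)) ≤ (walkLaw α x).real (returnsAt (1, 0)) := by
  induction n with
  | zero =>
    intro x hx hn
    have h0 : x ≠ (0, 0) := fun h => by rw [maxNorm_eq_zero_iff.2 h] at hn; omega
    obtain ⟨a, b, c, d, ha, hb, hc, hd, hma, hmb, -, -, hsum⟩ := sum_transProb_axis hx h0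
    have ha0 : a = (0, 0) := maxNorm_eq_zero_iff.1 (by rw [hma, hn]; rfl)
    have hone : maxNorm x = 1 := by rw [hn]; rfl
    have hmono : (walkLaw α a).real (returnsAt (1, 0)) ≤
        (walkLaw α a).real (consPath x ⁻¹' returnsAt (1, 0)) := by
      refine ENNReal.toReal_mono (measure_ne_top _ _) (measure_mono_ae ?_)
      filter_upwards [ae_start α a] with ω hω hmem
      exact consPath_mem_returnsAt_of_axis (by rw [hω]; exact ha) hmem
    rw [real_walkLaw_step α x (measurableSet_returnsAt (1, 0)),
      hsum α fun y => (walkLaw α y).real (consPath x ⁻¹' returnsAt (1, 0)), hone]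
    have hz := le_real_returnsAt_zero α
    rw [← ha0] at hz
    norm_num
    have h1 := measureReal_nonneg (μ := walkLaw α b) (s := consPath x ⁻¹' returnsAt (1, 0))
    have h2 := measureReal_nonneg (μ := walkLaw α c) (s := consPath x ⁻¹' returnsAt (1, 0))
    have h3 := measureReal_nonneg (μ := walkLaw α d) (s := consPath x ⁻¹' returnsAt (1, 0))
    linarith
  | succ n ih =>
    intro x hx hn
    have h0 : x ≠ (0, 0) := fun h => by rw [maxNorm_eq_zero_iff.2 h] at hn; omega
    obtain ⟨a, b, c, d, ha, hb, hc, hd, hma, hmb, -, -, hsum⟩ := sum_transProb_axis hx h0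
    have hmono : (walkLaw α a).real (returnsAt (1, 0)) ≤
        (walkLaw α a).real (consPath x ⁻¹' returnsAt (1, 0)) := by
      refine ENNReal.toReal_mono (measure_ne_top _ _) (measure_mono_ae ?_)
      filter_upwards [ae_start α a] with ω hω hmem
      exact consPath_mem_returnsAt_of_axis (by rw [hω]; exact ha) hmem
    have hi := ih a ha (by rw [hma, hn]; push_cast; ring)
    have hr : (1 : ℝ) ≤ maxNorm x := by exact_mod_cast maxNorm_pos_of_ne h0
    have h3 := pow_three_le_rpow hα hr
    rw [real_walkLaw_step α x (measurableSet_returnsAt (1, 0)),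
      hsum α fun y => (walkLaw α y).real (consPath x ⁻¹' returnsAt (1, 0))]
    have h1 := measureReal_nonneg (μ := walkLaw α b) (s := consPath x ⁻¹' returnsAt (1, 0))
    have h2 := measureReal_nonneg (μ := walkLaw α c) (s := consPath x ⁻¹' returnsAt (1, 0))
    have h4 := measureReal_nonneg (μ := walkLaw α d) (s := consPath x ⁻¹' returnsAt (1, 0))
    have hmx : (maxNorm x : ℝ) = n + 2 := by rw [hn]; push_cast; ring
    rw [hmx] at h3 ⊢
    set i : ℝ := (n : ℝ) + 2 with hidef
    have hi2 : 2 ≤ i := by rw [hidef]; linarith [(Nat.cast_nonneg n : (0 : ℝ) ≤ n)]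
    have hn1 : (n : ℝ) + 1 = i - 1 := by rw [hidef]; ring
    have hn2 : ((n + 1 : ℕ) : ℝ) + 1 = i := by rw [hidef]; push_cast; ring
    rw [hn1] at hi
    rw [hn2]
    have he : 0 ≤ 1 / (4 * i ^ (α : ℝ)) := by positivity
    have h5 : 3 / (4 * i ^ (α : ℝ)) ≤ 1 / i ^ 2 := by
      calc 3 / (4 * i ^ (α : ℝ)) ≤ 3 / (4 * i ^ 3) := by gcongr
        _ = 1 / i ^ 2 * (3 / (4 * i)) := by field_simp
        _ ≤ 1 / i ^ 2 * 1 := by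
          gcongr
          rw [div_le_one (by positivity)]; linarith
        _ = 1 / i ^ 2 := mul_one _
    have h6 : 0 ≤ 1 - 1 / i ^ 2 := by
      rw [sub_nonneg, div_le_one (by positivity)]
      nlinarith
    calc 1 / 512 * (1 + 1 / i) = (1 - 1 / i ^ 2) * (1 / 512 * (1 + 1 / (i - 1))) := by
          have : i - 1 ≠ 0 := by linarith
          field_simp
          ring
      _ ≤ (1 - 3 / (4 * i ^ (α : ℝ))) *
          (walkLaw α a).real (consPath x ⁻¹' returnsAt (1, 0)) := by
          have h7 : 0 ≤ 1 / (i - 1) := one_div_nonneg.2 (by linarith)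
          refine mul_le_mul (by linarith) (hi.trans hmono) (by positivity) (by linarith)
      _ ≤ _ := le_add_of_nonneg_right (mul_nonneg he (by linarith))

/-- Doeblin's condition for the chain of the entrance points in the axis. -/
theorem le_returnProb {α : ℝ≥0} (hα : 3 < α) (y : axis) :
    (ENNReal.ofReal (1 / 512)) ≤ returnProb α y ⟨(1, 0), one_zero_mem_axis⟩ := by
  have h : 1 / 512 ≤ (walkLaw α y).real (returnsAt (1, 0)) := by
    by_cases h0 : (y : ℤ × ℤ) = (0, 0)
    · rw [h0]
      exact le_trans (by norm_num) (le_real_returnsAt_zero α)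
    · have h1 := maxNorm_pos_of_ne h0
      refine le_trans ?_ (le_real_returnsAt_of_pos hα (maxNorm (y : ℤ × ℤ) - 1).toNat y y.2
        (by omega))
      have : (0 : ℝ) ≤ 1 / (((maxNorm (y : ℤ × ℤ) - 1).toNat : ℝ) + 1) := by positivity
      linarith
  exact (ENNReal.ofReal_le_iff_le_toReal (measure_ne_top _ _)).2 h

/-! ### The stationary walk and its weak law of large numbers -/

section

/-- The law of the walk whose starting point on the axis has law `p`. -/
noncomputable def mixedLaw (α : ℝ≥0) (p : axis → ℝ≥0∞) : Measure (ℕ → ℤ × ℤ) :=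
  Measure.sum fun y : axis => p y • walkLaw α y

theorem lintegral_mixedLaw (α : ℝ≥0) (p : axis → ℝ≥0∞) (H : (ℕ → ℤ × ℤ) → ℝ≥0∞) :
    ∫⁻ ω, H ω ∂(mixedLaw α p) = ∑' y : axis, p y * ∫⁻ ω, H ω ∂(walkLaw α y) := by
  rw [mixedLaw, lintegral_sum_measure]
  exact tsum_congr fun y => by rw [lintegral_smul_measure, smul_eq_mul]

theorem mixedLaw_apply (α : ℝ≥0) (p : axis → ℝ≥0∞) {s : Set (ℕ → ℤ × ℤ)} (hs : MeasurableSet s) :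
    mixedLaw α p s = ∑' y : axis, p y * walkLaw α y s := by
  rw [mixedLaw, Measure.sum_apply _ hs]
  rfl

theorem mixedLaw_univ (α : ℝ≥0) {p : axis → ℝ≥0∞} (hp : ∑' y, p y = 1) :
    mixedLaw α p Set.univ = 1 := by
  rw [mixedLaw_apply α p MeasurableSet.univ]
  simpa using hp

theorem IsSojournFunctional.const {β : Type*} (b : β) :
    IsSojournFunctional (fun _ => b) := fun _ _ _ _ _ => rfl

theorem lintegral_comp_returnShift {α : ℝ≥0} (hα : 3 < α) (y : axis) {H : (ℕ → ℤ × ℤ) → ℝ≥0∞}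
    (hH : Measurable H) :
    ∫⁻ ω, H (returnShift ω) ∂(walkLaw α y) =
      ∑' x : axis, returnProb α y x * ∫⁻ ω, H ω ∂(walkLaw α x) := by
  have h := lintegral_mul_returnShift hα y measurable_const (IsSojournFunctional.const 1) hH
  simp only [one_mul] at h
  rw [h, lintegral_return hα y fun x => ∫⁻ ω, H ω ∂(walkLaw α x)]

variable {α : ℝ≥0} {p : axis → ℝ≥0∞}

theorem lintegral_mixedLaw_comp_returnShift (hα : 3 < α)
    (hinv : ∀ x, ∑' y, p y * returnProb α y x = p x) {H : (ℕ → ℤ × ℤ) → ℝ≥0∞}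
    (hH : Measurable H) :
    ∫⁻ ω, H (returnShift ω) ∂(mixedLaw α p) = ∫⁻ ω, H ω ∂(mixedLaw α p) := by
  rw [lintegral_mixedLaw, lintegral_mixedLaw]
  simp only [lintegral_comp_returnShift hα _ hH, ← ENNReal.tsum_mul_left]
  rw [ENNReal.tsum_comm]
  refine tsum_congr fun x => ?_
  rw [← hinv x, ← ENNReal.tsum_mul_right]
  exact tsum_congr fun y => (mul_assoc _ _ _).symm

theorem measurable_iterate_returnShift (k : ℕ) : Measurable (returnShift^[k]) :=
  measurable_returnShift.iterate k

theorem measurable_comp_iterate {F : (ℕ → ℤ × ℤ) → ℝ≥0∞} (hF : Measurable F) (k : ℕ) :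
    Measurable fun ω => F (returnShift^[k] ω) :=
  hF.comp (measurable_iterate_returnShift k)

theorem lintegral_mixedLaw_iterate (hα : 3 < α)
    (hinv : ∀ x, ∑' y, p y * returnProb α y x = p x) {H : (ℕ → ℤ × ℤ) → ℝ≥0∞}
    (hH : Measurable H) (k : ℕ) :
    ∫⁻ ω, H (returnShift^[k] ω) ∂(mixedLaw α p) = ∫⁻ ω, H ω ∂(mixedLaw α p) := by
  induction k with
  | zero => rfl
  | succ k ih =>
    rw [← ih]
    exact lintegral_mixedLaw_comp_returnShift hα hinv (hH.comp (measurable_iterate_returnShift k))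

/-- The sum of a functional over the first `n` cycles of the walk. -/
noncomputable def cycleSum (F : (ℕ → ℤ × ℤ) → ℝ≥0∞) (n : ℕ) (ω : ℕ → ℤ × ℤ) : ℝ≥0∞ :=
  ∑ k ∈ Finset.range n, F (returnShift^[k] ω)

theorem measurable_cycleSum {F : (ℕ → ℤ × ℤ) → ℝ≥0∞} (hF : Measurable F) (n : ℕ) :
    Measurable (cycleSum F n) :=
  Finset.measurable_fun_sum _ fun k _ => hF.comp (measurable_iterate_returnShift k)

theorem cycleSum_succ (F : (ℕ → ℤ × ℤ) → ℝ≥0∞) (n : ℕ) (ω : ℕ → ℤ × ℤ) :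
    cycleSum F (n + 1) ω = F ω + cycleSum F n (returnShift ω) := by
  rw [cycleSum, Finset.sum_range_succ', add_comm]
  rfl

theorem lintegral_cycleSum (hα : 3 < α)
    (hinv : ∀ x, ∑' y, p y * returnProb α y x = p x) {F : (ℕ → ℤ × ℤ) → ℝ≥0∞}
    (hF : Measurable F) (n : ℕ) :
    ∫⁻ ω, cycleSum F n ω ∂(mixedLaw α p) = n * ∫⁻ ω, F ω ∂(mixedLaw α p) := by
  simp only [cycleSum]
  rw [lintegral_finsetSum _ fun k _ => measurable_comp_iterate hF k]
  simp [lintegral_mixedLaw_iterate hα hinv hF]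

/-- The lower bound in Doeblin's condition. -/
noncomputable def doeblinConst : ℝ≥0∞ := ENNReal.ofReal (1 / 512)

theorem doeblinConst_ne_zero : doeblinConst ≠ 0 := by simp [doeblinConst]

/-- Each cycle contracts the oscillation over the starting points by `1 - doeblinConst`. The lower
end of the oscillation interval is at most the stationary mean, which is an average of values in it.
-/
theorem lintegral_iterate_le (hα : 3 < α) (hp : ∑' y, p y = 1)
    (hinv : ∀ x, ∑' y, p y * returnProb α y x = p x) {F : (ℕ → ℤ × ℤ) → ℝ≥0∞}
    (hF : Measurable F) {b : ℝ≥0∞} (hb : ∀ ω, F ω ≤ b) (k : ℕ) (y : axis) :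
    ∫⁻ ω, F (returnShift^[k] ω) ∂(walkLaw α y) ≤
      ∫⁻ ω, F ω ∂(mixedLaw α p) + (1 - doeblinConst) ^ k * b := by
  have hosc : ∀ k : ℕ, ∃ a, ∀ y : axis,
      a ≤ ∫⁻ ω, F (returnShift^[k] ω) ∂(walkLaw α y) ∧
      ∫⁻ ω, F (returnShift^[k] ω) ∂(walkLaw α y) ≤ a + (1 - doeblinConst) ^ k * b := by
    intro k
    induction k with
    | zero =>
      refine ⟨0, fun y => ⟨zero_le, ?_⟩⟩
      calc ∫⁻ ω, F (returnShift^[0] ω) ∂(walkLaw α y)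
          ≤ ∫⁻ _, b ∂(walkLaw α y) := lintegral_mono fun ω => hb _
        _ = 0 + (1 - doeblinConst) ^ 0 * b := by simp
    | succ k ih =>
      obtain ⟨a, ha⟩ := ih
      obtain ⟨a', ha'⟩ := exists_oscillation_le (tsum_returnProb hα) (le_returnProb hα) ha
      refine ⟨a', fun y => ?_⟩
      have hstep : ∫⁻ ω, F (returnShift^[k + 1] ω) ∂(walkLaw α y) =
          ∑' x : axis, returnProb α y x * ∫⁻ ω, F (returnShift^[k] ω) ∂(walkLaw α x) :=
        lintegral_comp_returnShift hα y (hF.comp (measurable_iterate_returnShift k))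
      rw [hstep, pow_succ', mul_assoc]
      exact ha' y
  obtain ⟨a, ha⟩ := hosc k
  refine (ha y).2.trans ?_
  gcongr
  rw [← lintegral_mixedLaw_iterate hα hinv hF k, lintegral_mixedLaw]
  calc a = ∑' y, p y * a := by rw [ENNReal.tsum_mul_right, hp, one_mul]
    _ ≤ _ := ENNReal.tsum_le_tsum fun y => by gcongr; exact (ha y).1

theorem doeblinConst_le_one : doeblinConst ≤ 1 := by
  rw [doeblinConst, ENNReal.ofReal_le_one]; norm_num

/-- The geometric errors sum to `doeblinConst⁻¹ * b`, uniformly in `n` and in the starting point. -/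
theorem lintegral_cycleSum_le (hα : 3 < α) (hp : ∑' y, p y = 1)
    (hinv : ∀ x, ∑' y, p y * returnProb α y x = p x) {F : (ℕ → ℤ × ℤ) → ℝ≥0∞}
    (hF : Measurable F) {b : ℝ≥0∞} (hb : ∀ ω, F ω ≤ b) (n : ℕ) (y : axis) :
    ∫⁻ ω, cycleSum F n ω ∂(walkLaw α y) ≤
      n * ∫⁻ ω, F ω ∂(mixedLaw α p) + doeblinConst⁻¹ * b := by
  simp only [cycleSum]
  rw [lintegral_finsetSum _ fun k _ => measurable_comp_iterate hF k]
  calc ∑ k ∈ Finset.range n, ∫⁻ ω, F (returnShift^[k] ω) ∂(walkLaw α y)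
      ≤ ∑ k ∈ Finset.range n, (∫⁻ ω, F ω ∂(mixedLaw α p) + (1 - doeblinConst) ^ k * b) :=
        Finset.sum_le_sum fun k _ => lintegral_iterate_le hα hp hinv hF hb k y
    _ = n * ∫⁻ ω, F ω ∂(mixedLaw α p) + (∑ k ∈ Finset.range n, (1 - doeblinConst) ^ k) * b := by
        rw [Finset.sum_add_distrib, Finset.sum_const, Finset.card_range, nsmul_eq_mul,
          Finset.sum_mul]
    _ ≤ _ := by
        gcongr
        calc ∑ k ∈ Finset.range n, (1 - doeblinConst) ^ k
            ≤ ∑' k, (1 - doeblinConst) ^ k := ENNReal.sum_le_tsum _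
          _ = doeblinConst⁻¹ := by
            rw [ENNReal.tsum_geometric,
              ENNReal.sub_sub_cancel ENNReal.one_ne_top doeblinConst_le_one]

/-- After the first cycle the walk restarts from some point of the axis, and the preceding bound
does not depend on which. This replaces a covariance estimate. -/
theorem lintegral_mul_cycleSum_le (hα : 3 < α) (hp : ∑' y, p y = 1)
    (hinv : ∀ x, ∑' y, p y * returnProb α y x = p x) {F : (ℕ → ℤ × ℤ) → ℝ≥0∞}
    (hF : Measurable F) (hFs : IsSojournFunctional F) {b : ℝ≥0∞} (hb : ∀ ω, F ω ≤ b) (n : ℕ) :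
    ∫⁻ ω, F ω * cycleSum F n (returnShift ω) ∂(mixedLaw α p) ≤
      (∫⁻ ω, F ω ∂(mixedLaw α p)) *
        (n * ∫⁻ ω, F ω ∂(mixedLaw α p) + doeblinConst⁻¹ * b) := by
  set μ := ∫⁻ ω, F ω ∂(mixedLaw α p) with hμ
  have hμ' : μ = ∑' y : axis, p y * ∫⁻ ω, F ω ∂(walkLaw α y) := lintegral_mixedLaw α p F
  rw [lintegral_mixedLaw]
  nth_rw 1 [hμ']
  rw [← ENNReal.tsum_mul_right]
  refine ENNReal.tsum_le_tsum fun y => ?_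
  rw [lintegral_mul_returnShift hα y hF hFs (measurable_cycleSum hF n), mul_assoc]
  gcongr
  rw [← lintegral_mul_const _ hF]
  refine lintegral_mono_ae ?_
  filter_upwards [ae_isRegular hα y] with ω hω
  gcongr
  exact lintegral_cycleSum_le hα hp hinv hF hb n ⟨_, hω.returnTime_mem⟩

/-- Expand the square of `F` plus the sum over the later cycles: stationarity returns the square for
`n`, and the cross term exceeds `n * μ ^ 2` by a quantity independent of `n`. -/
theorem lintegral_cycleSum_sq_le (hα : 3 < α) (hp : ∑' y, p y = 1)
    (hinv : ∀ x, ∑' y, p y * returnProb α y x = p x) {F : (ℕ → ℤ × ℤ) → ℝ≥0∞}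
    (hF : Measurable F) (hFs : IsSojournFunctional F) {b : ℝ≥0∞} (hb : ∀ ω, F ω ≤ b) (n : ℕ) :
    ∫⁻ ω, cycleSum F n ω ^ 2 ∂(mixedLaw α p) ≤
      (n * ∫⁻ ω, F ω ∂(mixedLaw α p)) ^ 2 + n * (b ^ 2 + 2 * b * (doeblinConst⁻¹ * b)) := by
  set μ := ∫⁻ ω, F ω ∂(mixedLaw α p) with hμ
  have hμb : μ ≤ b := by
    calc μ ≤ ∫⁻ _, b ∂(mixedLaw α p) := lintegral_mono hb
      _ = b := by rw [lintegral_const, mixedLaw_univ α hp, mul_one]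
  induction n with
  | zero => simp [cycleSum]
  | succ n ih =>
    have hS := measurable_cycleSum hF n
    have hST : Measurable fun ω => cycleSum F n (returnShift ω) := hS.comp measurable_returnShift
    have hFST : Measurable fun ω => F ω * cycleSum F n (returnShift ω) := hF.mul hST
    have hexp : ∀ ω, cycleSum F (n + 1) ω ^ 2 = F ω ^ 2 +
        (2 * (F ω * cycleSum F n (returnShift ω)) + cycleSum F n (returnShift ω) ^ 2) := by
      intro ω
      rw [cycleSum_succ]
      ring
    simp only [hexp]
    rw [lintegral_add_left (hF.pow_const 2), lintegral_add_left (hFST.const_mul 2),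
      lintegral_const_mul 2 hFST,
      lintegral_mixedLaw_comp_returnShift hα hinv (H := fun ω => cycleSum F n ω ^ 2)
        (hS.pow_const 2)]
    have h1 : ∫⁻ ω, F ω ^ 2 ∂(mixedLaw α p) ≤ b ^ 2 := by
      calc ∫⁻ ω, F ω ^ 2 ∂(mixedLaw α p) ≤ ∫⁻ _, b ^ 2 ∂(mixedLaw α p) :=
            lintegral_mono fun ω => by gcongr; exact hb ω
        _ = b ^ 2 := by rw [lintegral_const, mixedLaw_univ α hp, mul_one]
    calc _ ≤ b ^ 2 + (2 * (μ * (n * μ + doeblinConst⁻¹ * b)) +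
          ((n * μ) ^ 2 + n * (b ^ 2 + 2 * b * (doeblinConst⁻¹ * b)))) := by
          gcongr
          exact lintegral_mul_cycleSum_le hα hp hinv hF hFs hb n
      -- The extra `μ ^ 2` completes the square `((n + 1) * μ) ^ 2`.
      _ ≤ b ^ 2 + (2 * μ * (n * μ) + 2 * b * (doeblinConst⁻¹ * b) +
          ((n * μ) ^ 2 + n * (b ^ 2 + 2 * b * (doeblinConst⁻¹ * b)))) + μ ^ 2 := by
          rw [mul_add μ, mul_add 2, ← mul_assoc 2 μ, ← mul_assoc 2 μ]
          refine le_trans ?_ le_self_add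
          gcongr
      _ = _ := by push_cast; ring

/-- The distance of two extended nonnegative reals. -/
noncomputable def gap (a b : ℝ≥0∞) : ℝ≥0∞ := (a - b) + (b - a)

theorem gap_comm (a b : ℝ≥0∞) : gap a b = gap b a := add_comm _ _

/-- The expansion of `(a - b) ^ 2` with the cross term moved to the other side, since subtraction in
`ℝ≥0∞` truncates. -/
theorem gap_sq {a b : ℝ≥0∞} (ha : a ≠ ⊤) (hb : b ≠ ⊤) :
    gap a b ^ 2 + 2 * (a * b) = a ^ 2 + b ^ 2 := by
  wlog h : a ≤ b generalizing a b
  · rw [gap_comm, mul_comm a b, this hb ha (le_of_not_ge h), add_comm]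
  · obtain ⟨d, rfl⟩ := exists_add_of_le h
    rw [gap, tsub_eq_zero_of_le h, ENNReal.add_sub_cancel_left ha]
    ring

theorem gap_add_le (a b c d : ℝ≥0∞) : gap (a + c) (b + d) ≤ gap a b + c + d := by
  have h1 : a + c - (b + d) ≤ (a - b) + c := by
    calc a + c - (b + d) ≤ a + c - b := tsub_le_tsub_left le_self_add _
      _ ≤ (a - b) + c := add_tsub_le_tsub_add
  have h2 : b + d - (a + c) ≤ (b - a) + d := by
    calc b + d - (a + c) ≤ b + d - a := tsub_le_tsub_left le_self_add _
      _ ≤ (b - a) + d := add_tsub_le_tsub_add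
  calc gap (a + c) (b + d) ≤ (a - b) + c + ((b - a) + d) := add_le_add h1 h2
    _ = gap a b + c + d := by rw [gap]; ring

theorem measurable_gap_const {F : (ℕ → ℤ × ℤ) → ℝ≥0∞} (hF : Measurable F) (b : ℝ≥0∞) :
    Measurable fun ω => gap (F ω) b :=
  (hF.sub_const b).add (hF.const_sub b)

theorem lintegral_gap_sq_le (hα : 3 < α) (hp : ∑' y, p y = 1)
    (hinv : ∀ x, ∑' y, p y * returnProb α y x = p x) {F : (ℕ → ℤ × ℤ) → ℝ≥0∞}
    (hF : Measurable F) (hFs : IsSojournFunctional F) {b : ℝ≥0∞} (hbt : b ≠ ⊤)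
    (hb : ∀ ω, F ω ≤ b) (n : ℕ) :
    ∫⁻ ω, gap (cycleSum F n ω) (n * ∫⁻ ω, F ω ∂(mixedLaw α p)) ^ 2 ∂(mixedLaw α p) ≤
      n * (b ^ 2 + 2 * b * (doeblinConst⁻¹ * b)) := by
  have hsum := lintegral_cycleSum hα hinv hF n
  have hsq := lintegral_cycleSum_sq_le hα hp hinv hF hFs hb n
  have hμb : ∫⁻ ω, F ω ∂(mixedLaw α p) ≤ b := by
    calc ∫⁻ ω, F ω ∂(mixedLaw α p) ≤ ∫⁻ _, b ∂(mixedLaw α p) := lintegral_mono hb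
      _ = b := by rw [lintegral_const, mixedLaw_univ α hp, mul_one]
  set m := (n : ℝ≥0∞) * ∫⁻ ω, F ω ∂(mixedLaw α p) with hm
  have hmt : m ≠ ⊤ := ENNReal.mul_ne_top (ENNReal.natCast_ne_top n) (ne_top_of_le_ne_top hbt hμb)
  have hS := measurable_cycleSum hF n
  have hpt : ∀ ω, gap (cycleSum F n ω) m ^ 2 + 2 * (cycleSum F n ω * m) =
      cycleSum F n ω ^ 2 + m ^ 2 := fun ω =>
    gap_sq (ENNReal.sum_ne_top.2 fun k _ => ne_top_of_le_ne_top hbt (hb _)) hmt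
  have hint : ∫⁻ ω, gap (cycleSum F n ω) m ^ 2 ∂(mixedLaw α p) + 2 * (m * m) =
      ∫⁻ ω, cycleSum F n ω ^ 2 ∂(mixedLaw α p) + m ^ 2 := by
    calc ∫⁻ ω, gap (cycleSum F n ω) m ^ 2 ∂(mixedLaw α p) + 2 * (m * m)
        = ∫⁻ ω, (gap (cycleSum F n ω) m ^ 2 + 2 * (cycleSum F n ω * m)) ∂(mixedLaw α p) := by
          rw [lintegral_add_left ((measurable_gap_const hS m).pow_const 2),
            lintegral_const_mul _ (hS.mul_const m), lintegral_mul_const _ hS, hsum]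
      _ = ∫⁻ ω, (cycleSum F n ω ^ 2 + m ^ 2) ∂(mixedLaw α p) := lintegral_congr hpt
      _ = _ := by
          rw [lintegral_add_left (hS.pow_const 2), lintegral_const, mixedLaw_univ α hp, mul_one]
  have hcancel : 2 * (m * m) ≠ ⊤ :=
    ENNReal.mul_ne_top ENNReal.ofNat_ne_top (ENNReal.mul_ne_top hmt hmt)
  refine (ENNReal.add_le_add_iff_right hcancel).1 ?_
  rw [hint]
  calc _ ≤ m ^ 2 + n * (b ^ 2 + 2 * b * (doeblinConst⁻¹ * b)) + m ^ 2 := by gcongr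
    _ = _ := by ring

theorem tendsto_lintegral_sub_min {F : (ℕ → ℤ × ℤ) → ℝ≥0∞}
    (hF : Measurable F) (hfin : ∫⁻ ω, F ω ∂(mixedLaw α p) ≠ ⊤) :
    Tendsto (fun M : ℕ => ∫⁻ ω, (F ω - min (F ω) M) ∂(mixedLaw α p)) atTop (𝓝 0) := by
  have h := tendsto_lintegral_of_dominated_convergence (μ := mixedLaw α p)
    (F := fun (M : ℕ) ω => F ω - min (F ω) M) (f := fun _ => 0) F
    (fun M => hF.sub (hF.min measurable_const)) (fun M => ae_of_all _ fun ω => tsub_le_self) hfin ?_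
  · simpa using h
  · filter_upwards [ae_lt_top hF hfin] with ω hω
    obtain ⟨M, hM⟩ := ENNReal.exists_nat_gt hω.ne
    refine tendsto_const_nhds.congr' ?_
    filter_upwards [eventually_ge_atTop M] with k hk
    have : F ω ≤ k := hM.le.trans (by exact_mod_cast hk)
    rw [min_eq_left this, tsub_self]

theorem IsSojournFunctional.min_const {F : (ℕ → ℤ × ℤ) → ℝ≥0∞} (hF : IsSojournFunctional F)
    (b : ℝ≥0∞) : IsSojournFunctional fun ω => min (F ω) b := fun n ω ω' h hn => by
  simp only [hF n ω ω' h hn]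

/-- The weak law of large numbers for the cycles of the stationary walk. -/
theorem tendsto_mixedLaw_gap (hα : 3 < α) (hp : ∑' y, p y = 1)
    (hinv : ∀ x, ∑' y, p y * returnProb α y x = p x) {F : (ℕ → ℤ × ℤ) → ℝ≥0∞}
    (hF : Measurable F) (hFs : IsSojournFunctional F)
    (hfin : ∫⁻ ω, F ω ∂(mixedLaw α p) ≠ ⊤) {ε : ℝ≥0∞} (hε : ε ≠ 0) (hεt : ε ≠ ⊤) :
    Tendsto (fun n : ℕ => mixedLaw α p
      {ω | n * ε ≤ gap (cycleSum F n ω) (n * ∫⁻ ω, F ω ∂(mixedLaw α p))}) atTop (𝓝 0) := by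
  rw [ENNReal.tendsto_nhds_zero]
  intro δ hδ
  -- One third each for the fluctuation of the truncated sum, the sum of the remainders, and the
  -- mean of that sum.
  set η := ε / 3 with hη
  have hη0 : η ≠ 0 := (ENNReal.div_pos hε ENNReal.ofNat_ne_top).ne'
  have hηt : η ≠ ⊤ := ENNReal.div_ne_top hεt (by norm_num)
  have hη3 : η + η + η = ε := ENNReal.add_thirds ε
  wlog hδt : δ ≠ ⊤ generalizing δ
  · push Not at hδt
    subst hδt
    exact Eventually.of_forall fun n => le_top
  -- The first bound makes the mean of the remainder negligible; the second makes Markov's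
  -- inequality give probability at most `δ / 2`, for every `n` at once.
  obtain ⟨M, hM1, hM2⟩ : ∃ M : ℕ, ∫⁻ ω, (F ω - min (F ω) M) ∂(mixedLaw α p) < η ∧
      ∫⁻ ω, (F ω - min (F ω) M) ∂(mixedLaw α p) < η * (δ / 2) := by
    have h := tendsto_lintegral_sub_min hF hfin
    have h2 : 0 < η * (δ / 2) :=
      ENNReal.mul_pos hη0 (ENNReal.div_pos hδ.ne' ENNReal.ofNat_ne_top).ne'
    exact ((h.eventually (gt_mem_nhds (pos_iff_ne_zero.2 hη0))).and
      (h.eventually (gt_mem_nhds h2))).exists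
  set f : (ℕ → ℤ × ℤ) → ℝ≥0∞ := fun ω => min (F ω) M with hf
  set g : (ℕ → ℤ × ℤ) → ℝ≥0∞ := fun ω => F ω - min (F ω) M with hg
  have hfm : Measurable f := hF.min measurable_const
  have hgm : Measurable g := hF.sub hfm
  have hfg : ∀ ω, F ω = f ω + g ω := fun ω => (add_tsub_cancel_of_le (min_le_left _ _)).symm
  have hsumfg : ∀ n ω, cycleSum F n ω = cycleSum f n ω + cycleSum g n ω := fun n ω => by
    simp only [cycleSum, ← Finset.sum_add_distrib, ← hfg]
  have hintfg : ∫⁻ ω, F ω ∂(mixedLaw α p) =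
      ∫⁻ ω, f ω ∂(mixedLaw α p) + ∫⁻ ω, g ω ∂(mixedLaw α p) := by
    rw [← lintegral_add_left hfm]
    exact lintegral_congr hfg
  set μ := ∫⁻ ω, f ω ∂(mixedLaw α p) with hμ
  set ν := ∫⁻ ω, g ω ∂(mixedLaw α p) with hν
  set C : ℝ≥0∞ := (M : ℝ≥0∞) ^ 2 + 2 * M * (doeblinConst⁻¹ * M) with hC
  have hCt : C ≠ ⊤ := by
    have := ENNReal.inv_ne_top.2 doeblinConst_ne_zero
    finiteness
  have hfvar : ∀ n : ℕ, ∫⁻ ω, gap (cycleSum f n ω) (n * μ) ^ 2 ∂(mixedLaw α p) ≤ n * C := fun n =>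
    lintegral_gap_sq_le hα hp hinv hfm (hFs.min_const M) (ENNReal.natCast_ne_top M)
      (fun ω => min_le_right _ _) n
  -- Chebyshev's inequality: a variance of at most `n * C` against the squared threshold `(n * η) ^
  -- 2`.
  have hA : ∀ n : ℕ, n ≠ 0 →
      mixedLaw α p {ω | n * η ≤ gap (cycleSum f n ω) (n * μ)} ≤ C / η ^ 2 / n := by
    intro n hn
    have hn0 : (n : ℝ≥0∞) ≠ 0 := by exact_mod_cast hn
    have hnt := ENNReal.natCast_ne_top n
    have hcheb := mul_meas_ge_le_lintegral (μ := mixedLaw α p)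
      ((measurable_gap_const (measurable_cycleSum hfm n) (n * μ)).pow_const 2) ((n * η) ^ 2)
    have hsub : mixedLaw α p {ω | n * η ≤ gap (cycleSum f n ω) (n * μ)} ≤
        mixedLaw α p {ω | (n * η) ^ 2 ≤ gap (cycleSum f n ω) (n * μ) ^ 2} :=
      measure_mono fun ω (hω : n * η ≤ _) => pow_le_pow_left' hω 2
    set P := mixedLaw α p {ω | n * η ≤ gap (cycleSum f n ω) (n * μ)}
    have h1 : (n * η) ^ 2 * P ≤ n * C := by
      calc (n * η) ^ 2 * P ≤ _ := by gcongr
        _ ≤ _ := hcheb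
        _ ≤ _ := hfvar n
    have h2 : (n : ℝ≥0∞) * (n * (η ^ 2 * P)) ≤ n * C := by
      calc (n : ℝ≥0∞) * (n * (η ^ 2 * P)) = (n * η) ^ 2 * P := by ring
        _ ≤ n * C := h1
    have h3 : n * (η ^ 2 * P) ≤ C := (ENNReal.mul_le_mul_iff_right hn0 hnt).1 h2
    rw [ENNReal.le_div_iff_mul_le (Or.inl hn0) (Or.inl hnt),
      ENNReal.le_div_iff_mul_le (Or.inl (pow_ne_zero 2 hη0)) (Or.inl (ENNReal.pow_ne_top hηt))]
    calc P * n * η ^ 2 = n * (η ^ 2 * P) := by ring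
      _ ≤ C := h3
  have hB : ∀ n : ℕ, n ≠ 0 → mixedLaw α p {ω | n * η ≤ cycleSum g n ω} ≤ δ / 2 := by
    intro n hn
    have hn0 : (n : ℝ≥0∞) ≠ 0 := by exact_mod_cast hn
    have hnt := ENNReal.natCast_ne_top n
    have hmark := mul_meas_ge_le_lintegral (μ := mixedLaw α p) (measurable_cycleSum hgm n) (n * η)
    rw [lintegral_cycleSum hα hinv hgm n, mul_assoc] at hmark
    have h1 := (ENNReal.mul_le_mul_iff_right hn0 hnt).1 hmark
    exact (ENNReal.mul_le_mul_iff_right hη0 hηt).1 (h1.trans hM2.le)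
  have hlim : Tendsto (fun n : ℕ => C / η ^ 2 / n) atTop (𝓝 0) := by
    have hCη : C / η ^ 2 ≠ ⊤ := ENNReal.div_ne_top hCt (pow_ne_zero 2 hη0)
    have := ENNReal.Tendsto.const_div (m := fun n : ℕ => (n : ℝ≥0∞)) (a := C / η ^ 2)
      ENNReal.tendsto_nat_nhds_top (Or.inr hCη)
    rwa [ENNReal.div_top] at this
  have hδ2 : 0 < δ / 2 := ENNReal.div_pos hδ.ne' ENNReal.ofNat_ne_top
  filter_upwards [eventually_gt_atTop 0, (ENNReal.tendsto_nhds_zero.1 hlim) _ hδ2] with n hn hnC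
  have hn0 : (n : ℝ≥0∞) ≠ 0 := by exact_mod_cast hn.ne'
  have hnt := ENNReal.natCast_ne_top n
  have hsub : {ω | n * ε ≤ gap (cycleSum F n ω) (n * ∫⁻ ω, F ω ∂(mixedLaw α p))} ⊆
      {ω | n * η ≤ gap (cycleSum f n ω) (n * μ)} ∪ {ω | n * η ≤ cycleSum g n ω} := by
    intro ω hω
    by_contra hnot
    simp only [Set.mem_union, Set.mem_ofPred_eq, not_or, not_le] at hnot
    have h3 : n * ν < n * η := (ENNReal.mul_lt_mul_iff_right hn0 hnt).2 hM1
    have hω' : n * ε ≤ gap (cycleSum F n ω) (n * ∫⁻ ω, F ω ∂(mixedLaw α p)) := hω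
    rw [hsumfg, hintfg, mul_add] at hω'
    have h4 := hω'.trans (gap_add_le _ _ _ _)
    rw [← hη3, mul_add, mul_add] at h4
    exact absurd h4 (not_le.2 (ENNReal.add_lt_add (ENNReal.add_lt_add hnot.1 hnot.2) h3))
  calc _ ≤ _ := measure_mono hsub
    _ ≤ _ := measure_union_le _ _
    _ ≤ δ / 2 + δ / 2 := add_le_add ((hA n hn.ne').trans hnC) (hB n hn.ne')
    _ = δ := ENNReal.add_halves δ

end

/-! ### Passing from the stationary walk to the walk started at `(1, 1)` -/

section

/-- The trajectory after its first entrance in the axis. -/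
noncomputable def entryShift (ω : ℕ → ℤ × ℤ) : ℕ → ℤ × ℤ := shiftPath (hit axis ω) ω

/-- The prolonged trajectory is in a cone at time `1`, so its first return to the axis is the first
entrance of `ω`. -/
theorem returnShift_consPath {x : ℤ × ℤ} {ω : ℕ → ℤ × ℤ} (h : IsRegular ω) (h0 : ω 0 ∈ cone) :
    returnShift (consPath x ω) = entryShift ω := by
  have h1 : returnTime (consPath x ω) = ((hit axis ω + 1 : ℕ) : ℕ∞) := by
    rw [returnTime_consPath_of_cone x h0, hitAfter_zero_eq_hit (h.1 0), Nat.cast_add, add_comm]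
    rfl
  rw [returnShift, h1, ENat.toNat_natCast, shiftPath_succ_consPath, entryShift]

variable {α : ℝ≥0} {p : axis → ℝ≥0∞}

theorem stepProb_mul_walkLaw_entryShift_le (hα : 3 < α) {s : Set (ℕ → ℤ × ℤ)}
    (hs : MeasurableSet s) :
    stepProb α (1, 0) (1, 1) * walkLaw α (1, 1) (entryShift ⁻¹' s) ≤
      walkLaw α (1, 0) (returnShift ⁻¹' s) := by
  rw [walkLaw_step α (1, 0) (measurable_returnShift hs)]
  have hmem : ((1, 1) : ℤ × ℤ) ∈ neighbors (1, 0) := by simp [neighbors]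
  refine le_trans ?_ (Finset.single_le_sum (f := fun y => stepProb α (1, 0) y *
    walkLaw α y (consPath (1, 0) ⁻¹' (returnShift ⁻¹' s))) (fun _ _ => zero_le) hmem)
  refine mul_le_mul_right (measure_mono_ae ?_) _
  filter_upwards [ae_start α (1, 1), ae_isRegular hα (1, 1)] with ω h0 hreg hω
  change returnShift (consPath (1, 0) ω) ∈ s
  rw [returnShift_consPath hreg (by rw [h0]; exact one_one_mem_cone)]
  exact hω

theorem mixedLaw_returnShift_preimage (hα : 3 < α)
    (hinv : ∀ x, ∑' y, p y * returnProb α y x = p x) {s : Set (ℕ → ℤ × ℤ)}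
    (hs : MeasurableSet s) : mixedLaw α p (returnShift ⁻¹' s) = mixedLaw α p s := by
  rw [← lintegral_indicator_one hs, ← lintegral_indicator_one (measurable_returnShift hs),
    ← lintegral_mixedLaw_comp_returnShift hα hinv (measurable_one.indicator hs)]
  rfl

theorem doeblinConst_le_mass (hα : 3 < α) (hp : ∑' y, p y = 1)
    (hinv : ∀ x, ∑' y, p y * returnProb α y x = p x) :
    doeblinConst ≤ p ⟨(1, 0), one_zero_mem_axis⟩ := by
  rw [← hinv]
  calc doeblinConst = ∑' y, p y * doeblinConst := by rw [ENNReal.tsum_mul_right, hp, one_mul]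
    _ ≤ _ := ENNReal.tsum_le_tsum fun y => by gcongr; exact le_returnProb hα y

/-- The law of the walk started from `(1, 1)`, seen from its first entrance in the axis on, is
dominated by a multiple of the stationary law. -/
theorem exists_walkLaw_entryShift_le (hα : 3 < α) (hp : ∑' y, p y = 1)
    (hinv : ∀ x, ∑' y, p y * returnProb α y x = p x) :
    ∃ K : ℝ≥0∞, K ≠ ⊤ ∧ ∀ s, MeasurableSet s →
      walkLaw α (1, 1) (entryShift ⁻¹' s) ≤ K * mixedLaw α p s := by
  set x₀ : axis := ⟨(1, 0), one_zero_mem_axis⟩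
  have hstep : stepProb α (1, 0) (1, 1) ≠ 0 := by
    rw [stepProb, transProb_one_zero]; simp
  have hmass : p x₀ ≠ 0 := fun h =>
    doeblinConst_ne_zero (le_antisymm (h ▸ doeblinConst_le_mass hα hp hinv) zero_le)
  have hne : p x₀ * stepProb α (1, 0) (1, 1) ≠ 0 := mul_ne_zero hmass hstep
  have hnt : p x₀ * stepProb α (1, 0) (1, 1) ≠ ⊤ := by
    refine ENNReal.mul_ne_top ?_ ENNReal.ofReal_ne_top
    exact ne_top_of_le_ne_top ENNReal.one_ne_top (hp ▸ ENNReal.le_tsum x₀)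
  -- With probability `p x₀ * stepProb α (1, 0) (1, 1)` the stationary walk starts at `(1, 0)` and
  -- steps to `(1, 1)`; its return is then the first entrance from there, and the shift by a cycle
  -- preserves the stationary law.
  refine ⟨(p x₀ * stepProb α (1, 0) (1, 1))⁻¹, ENNReal.inv_ne_top.2 hne, fun s hs => ?_⟩
  rw [← ENNReal.mul_le_iff_le_inv hne hnt]
  calc p x₀ * stepProb α (1, 0) (1, 1) * walkLaw α (1, 1) (entryShift ⁻¹' s)
      ≤ p x₀ * walkLaw α x₀ (returnShift ⁻¹' s) := by
        rw [mul_assoc]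
        gcongr
        exact stepProb_mul_walkLaw_entryShift_le hα hs
    _ ≤ ∑' y : axis, p y * walkLaw α y (returnShift ⁻¹' s) :=
        ENNReal.le_tsum (f := fun y : axis => p y * walkLaw α y (returnShift ⁻¹' s)) x₀
    _ = mixedLaw α p s := by
        rw [← mixedLaw_apply α p (measurable_returnShift hs),
          mixedLaw_returnShift_preimage hα hinv hs]

theorem gap_ofReal {a b : ℝ} (ha : 0 ≤ a) (hb : 0 ≤ b) :
    gap (ENNReal.ofReal a) (ENNReal.ofReal b) = ENNReal.ofReal |a - b| := by
  wlog h : b ≤ a generalizing a b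
  · rw [gap_comm, this hb ha (le_of_not_ge h), abs_sub_comm]
  · rw [gap, tsub_eq_zero_of_le (ENNReal.ofReal_le_ofReal h), add_zero,
      ← ENNReal.ofReal_sub _ hb, abs_of_nonneg (sub_nonneg.2 h)]

theorem mul_edist_eq_gap {μ : ℝ≥0∞} (hμ : μ ≠ ⊤) {n : ℕ} (hn : n ≠ 0) (L : ℕ) :
    n * edist (1 / (n : ℝ) * (L : ℝ)) μ.toReal = gap L (n * μ) := by
  have hn0 : (0 : ℝ) < n := by exact_mod_cast Nat.pos_of_ne_zero hn
  have h1 : (n : ℝ≥0∞) = ENNReal.ofReal n := (ENNReal.ofReal_natCast n).symm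
  have h2 : (L : ℝ≥0∞) = ENNReal.ofReal L := (ENNReal.ofReal_natCast L).symm
  have h3 : (n : ℝ≥0∞) * μ = ENNReal.ofReal (n * μ.toReal) := by
    rw [ENNReal.ofReal_mul hn0.le, ENNReal.ofReal_toReal hμ, ← h1]
  rw [h3, h2, gap_ofReal (Nat.cast_nonneg L) (mul_nonneg hn0.le ENNReal.toReal_nonneg), h1,
    edist_dist, Real.dist_eq, ← ENNReal.ofReal_mul hn0.le]
  congr 1
  rw [← abs_of_pos hn0, ← abs_mul, abs_of_pos hn0]
  congr 1
  field_simp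

/-- The deviation event, multiplied by `m`, is an event about `entryShift ω`, whose law is at most
`K` times the stationary law, so the stationary weak law bounds its probability. -/
theorem tendstoInMeasure_of_cycleSum (hα : 3 < α) (hp : ∑' y, p y = 1)
    (hinv : ∀ x, ∑' y, p y * returnProb α y x = p x) {F : (ℕ → ℤ × ℤ) → ℕ}
    (hF : Measurable F) (hFs : IsSojournFunctional F)
    (hfin : ∫⁻ ω, (F ω : ℝ≥0∞) ∂(mixedLaw α p) ≠ ⊤) {L : ℕ → (ℕ → ℤ × ℤ) → ℕ}
    (hL : ∀ᵐ ω ∂(walkLaw α (1, 1)), ∀ m,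
      L m ω = ∑ k ∈ Finset.range m, F (returnShift^[k] (entryShift ω))) :
    TendstoInMeasure (walkLaw α (1, 1)) (fun (m : ℕ) ω => (1 / (m : ℝ)) * (L m ω : ℝ)) atTop
      (fun _ => (∫⁻ ω, (F ω : ℝ≥0∞) ∂(mixedLaw α p)).toReal) := by
  obtain ⟨K, hK, hle⟩ := exists_walkLaw_entryShift_le hα hp hinv
  have hFm : Measurable fun ω => (F ω : ℝ≥0∞) :=
    (Measurable.of_discrete (f := fun n : ℕ => (n : ℝ≥0∞))).comp hF
  have hFs' : IsSojournFunctional fun ω => (F ω : ℝ≥0∞) := fun n ω ω' h hn => by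
    simp only [hFs n ω ω' h hn]
  refine tendstoInMeasure_of_ne_top fun ε hε hεt => ?_
  set μ := ∫⁻ ω, (F ω : ℝ≥0∞) ∂(mixedLaw α p) with hμ
  have hlim := tendsto_mixedLaw_gap hα hp hinv hFm hFs' hfin hε.ne' hεt
  have hlim2 := ENNReal.Tendsto.const_mul hlim (Or.inr hK)
  rw [mul_zero] at hlim2
  refine tendsto_of_tendsto_of_tendsto_of_le_of_le' tendsto_const_nhds hlim2
    (Eventually.of_forall fun _ => zero_le) ?_
  filter_upwards [eventually_gt_atTop 0] with m hm
  have hms : MeasurableSet {ω | m * ε ≤ gap (cycleSum (fun ω => (F ω : ℝ≥0∞)) m ω) (m * μ)} :=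
    measurableSet_le measurable_const (measurable_gap_const (measurable_cycleSum hFm m) _)
  refine le_trans (measure_mono_ae ?_) (hle _ hms)
  filter_upwards [hL] with ω hω h
  change m * ε ≤ gap (cycleSum (fun ω => (F ω : ℝ≥0∞)) m (entryShift ω)) (m * μ)
  have h1 : cycleSum (fun ω => (F ω : ℝ≥0∞)) m (entryShift ω) = (L m ω : ℝ≥0∞) := by
    rw [hω m, cycleSum]; push_cast; rfl
  rw [h1, ← mul_edist_eq_gap hfin hm.ne']
  have h' : ε ≤ edist (1 / (m : ℝ) * (L m ω : ℝ)) μ.toReal := h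
  gcongr

/-! ### Visits of the axis and of the origin, cycle by cycle -/

theorem visits_succ (A : Set (ℤ × ℤ)) (n : ℕ) (ω : ℕ → ℤ × ℤ) :
    visits A (n + 1) ω = visits A n ω + A.indicator 1 (ω (n + 1)) :=
  Finset.sum_range_succ _ _

theorem visits_eq_zero {A : Set (ℤ × ℤ)} {n : ℕ} {ω : ℕ → ℤ × ℤ}
    (h : ∀ k, 0 < k → k ≤ n → ω k ∉ A) : visits A n ω = 0 :=
  Finset.sum_eq_zero fun i hi =>
    Set.indicator_of_notMem (h (i + 1) (by omega) (Finset.mem_range.1 hi)) _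

theorem visits_eq_self {A : Set (ℤ × ℤ)} {n : ℕ} {ω : ℕ → ℤ × ℤ}
    (h : ∀ k, 0 < k → k ≤ n → ω k ∈ A) : visits A n ω = n := by
  rw [visits, Finset.sum_congr rfl fun i hi =>
    Set.indicator_of_mem (h (i + 1) (by omega) (Finset.mem_range.1 hi)) _]
  simp

theorem IsRegular.hit_axis_spec {ω : ℕ → ℤ × ℤ} (h : IsRegular ω) :
    0 < hit axis ω ∧ ω (hit axis ω) ∈ axis ∧ ∀ k : ℕ, 0 < k → k < hit axis ω → ω k ∉ axis :=
  hit_spec (h.1 0)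

theorem IsRegular.hit_cone_spec {ω : ℕ → ℤ × ℤ} (h : IsRegular ω) :
    0 < hit cone ω ∧ ω (hit cone ω) ∈ cone ∧ ∀ k : ℕ, 0 < k → k < hit cone ω → ω k ∉ cone :=
  hit_spec (h.2.1 0)

theorem IsRegular.visits_axis_hit_axis {ω : ℕ → ℤ × ℤ} (h : IsRegular ω) :
    visits axis (hit axis ω) ω = 1 := by
  obtain ⟨h1, h2, h3⟩ := h.hit_axis_spec
  obtain ⟨j, hj⟩ : ∃ j, hit axis ω = j + 1 := ⟨hit axis ω - 1, by omega⟩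
  rw [hj] at h2 h3 ⊢
  rw [visits_succ, visits_eq_zero fun k hk hkj => h3 k hk (by omega), Set.indicator_of_mem h2]
  simp

/-- Every positive time before the exit is spent on the axis and the exit time is not. -/
theorem IsRegular.visits_axis_hit_cone {ω : ℕ → ℤ × ℤ} (h : IsRegular ω) :
    visits axis (hit cone ω) ω + 1 = hit cone ω := by
  obtain ⟨h1, h2, h3⟩ := h.hit_cone_spec
  obtain ⟨j, hj⟩ : ∃ j, hit cone ω = j + 1 := ⟨hit cone ω - 1, by omega⟩
  rw [hj] at h2 h3 ⊢
  have h4 : ∀ k, 0 < k → k ≤ j → ω k ∈ axis := fun k hk hkj =>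
    not_not.1 (mem_cone_iff.not.1 (h3 k hk (by omega)))
  rw [visits_succ, visits_eq_self h4, Set.indicator_of_notMem (mem_cone_iff.1 h2),
    add_zero]

/-- The neighbours of the origin lie on the axis, so the excursion cannot enter the axis there. -/
theorem IsRegular.visits_zero_hit_axis {ω : ℕ → ℤ × ℤ} (h : IsRegular ω) (h0 : ω 0 ∈ cone) :
    visits {(0, 0)} (hit axis ω) ω = 0 := by
  obtain ⟨h1, -, h3⟩ := h.hit_axis_spec
  refine visits_eq_zero fun k hk hkh => ?_
  obtain ⟨j, rfl⟩ : ∃ j, k = j + 1 := ⟨k - 1, by omega⟩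
  refine h.2.2 j ?_
  rcases Nat.eq_zero_or_pos j with rfl | hj
  · exact h0
  · exact h3 j hj (by omega)

/-- The time spent on the axis before the first visit of the cones. -/
noncomputable def sojournTime (ω : ℕ → ℤ × ℤ) : ℕ := (rho ω).toNat

/-- The number of visits of the origin before the first visit of the cones. -/
noncomputable def sojournVisits (ω : ℕ → ℤ × ℤ) : ℕ := visits {(0, 0)} (rho ω).toNat ω

theorem measurable_sojournTime : Measurable sojournTime :=
  (Measurable.of_discrete (f := ENat.toNat)).comp measurable_rho

theorem measurable_sojournVisits : Measurable sojournVisits :=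
  measurable_visits _ measurable_sojournTime

theorem isSojournFunctional_sojournTime : IsSojournFunctional sojournTime :=
  fun n ω ω' h hn => by
    have h' : rho ω' = n := hitAfter_congr h hn
    rw [sojournTime, sojournTime, hn, h']

theorem isSojournFunctional_sojournVisits : IsSojournFunctional sojournVisits :=
  fun n ω ω' h hn => by
    have h' : rho ω' = n := hitAfter_congr h hn
    rw [sojournVisits, sojournVisits, hn, h']
    exact visits_congr _ h

theorem IsRegular.sojournTime_eq {ω : ℕ → ℤ × ℤ} (h : IsRegular ω) : sojournTime ω = hit cone ω := by
  rw [sojournTime, h.rho_eq, ENat.toNat_natCast]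

theorem IsRegular.returnTime_toNat {ω : ℕ → ℤ × ℤ} (h : IsRegular ω) : (returnTime ω).toNat =
    hit cone ω + hit axis (AxisWalk.shiftPath (hit cone ω) ω) := by
  rw [h.returnTime_eq, ENat.toNat_natCast]

/-- The decomposition of a regular trajectory into cycles. -/
theorem IsRegular.exists_rhoTime_eq {ω : ℕ → ℤ × ℤ} (h : IsRegular ω) (h0 : ω 0 ∈ cone) (m : ℕ) :
    ∃ r e : ℕ, rhoTime m ω = r ∧ ω r ∈ cone ∧ e = r + hit axis (AxisWalk.shiftPath r ω) ∧
      returnShift^[m] (entryShift ω) = AxisWalk.shiftPath e ω ∧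
      visits axis r ω = ∑ k ∈ Finset.range m, sojournTime (returnShift^[k] (entryShift ω)) ∧
      visits {(0, 0)} r ω =
        ∑ k ∈ Finset.range m, sojournVisits (returnShift^[k] (entryShift ω)) := by
  induction m with
  | zero =>
    refine ⟨0, hit axis ω, rfl, h0, by simp, rfl, by simp [visits], by simp [visits]⟩
  | succ m ih =>
    obtain ⟨r, e, hr, hrc, he, hT, hva, hvz⟩ := ih
    have hregr := h.shiftPath r
    have hreg := h.shiftPath e
    have hsplit : ∀ A : Set (ℤ × ℤ), visits A (e + hit cone (AxisWalk.shiftPath e ω)) ω =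
        visits A r ω + visits A (hit axis (AxisWalk.shiftPath r ω)) (AxisWalk.shiftPath r ω) +
          visits A (hit cone (AxisWalk.shiftPath e ω)) (AxisWalk.shiftPath e ω) := by
      intro A
      rw [visits_add, he, visits_add]
    refine ⟨e + hit cone (AxisWalk.shiftPath e ω), _, ?_, hreg.hit_cone_spec.2.1, rfl, ?_, ?_, ?_⟩
    · rw [rhoTime, hr, hitAfter_coe_eq_hit (h.1 r), ← he, hitAfter_coe_eq_hit (h.2.1 e)]
    · rw [Function.iterate_succ_apply', hT, returnShift, hreg.returnTime_toNat,
        shiftPath_shiftPath, shiftPath_shiftPath, add_assoc]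
    -- The entrance time counts for one visit, which makes up for the exit time missing from the
    -- sojourn: the cycle contributes exactly `hit cone`.
    · rw [hsplit, Finset.sum_range_succ, ← hva, hT, hreg.sojournTime_eq,
        hregr.visits_axis_hit_axis]
      have := hreg.visits_axis_hit_cone
      omega
    · rw [hsplit, Finset.sum_range_succ, ← hvz, hT, hregr.visits_zero_hit_axis hrc, add_zero,
        sojournVisits, hreg.rho_eq, ENat.toNat_natCast]

/-! ### Finiteness of the stationary means -/

theorem lintegral_sojournTime (hα : 3 < α) (x : ℤ × ℤ) :
    ∫⁻ ω, (sojournTime ω : ℝ≥0∞) ∂(walkLaw α x) = meanRho α x := by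
  refine lintegral_congr_ae ?_
  filter_upwards [ae_isRegular hα x] with ω hω
  rw [hω.sojournTime_eq, hω.rho_eq]
  rfl

theorem lintegral_sojournVisits (hα : 3 < α) (x : ℤ × ℤ) :
    ∫⁻ ω, (sojournVisits ω : ℝ≥0∞) ∂(walkLaw α x) = meanLocalTimeZero α x := by
  refine lintegral_congr_ae ?_
  filter_upwards [ae_isRegular hα x] with ω hω
  rw [sojournVisits, hω.rho_eq, localTime_coe]
  rfl

/-- The mean `ℓ¹` norm of the point of return to the axis is bounded. -/
theorem lintegral_taxiNorm_return_le (hα : 3 < α) {y : ℤ × ℤ} (hy : y ∈ axis) :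
    ∫⁻ ω, ENNReal.ofReal (taxiNorm (ω (returnTime ω).toNat)) ∂(walkLaw α y) ≤ 5 := by
  have hH : Measurable fun ω : ℕ → ℤ × ℤ => ENNReal.ofReal (taxiNorm (ω (hit axis ω))) :=
    (Measurable.of_discrete (f := fun x : ℤ × ℤ => ENNReal.ofReal (taxiNorm x))).comp
      (measurable_apply_time (measurable_hit axis))
  have hfin : ∀ᵐ ω ∂(walkLaw α y), rho ω ≠ ⊤ := by
    filter_upwards [ae_isRegular hα y] with ω hω
    rw [hω.rho_eq]; exact ENat.natCast_ne_top _
  -- Restarting at the exit from the axis, the excursion in the cone does not increase the mean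
  -- norm, and the norm at exit has mean at most `5`.
  have h := lintegral_strong_markov (N := rho) (F := fun _ => 1) measurable_rho measurable_const hH
    (fun n ω ω' h hn => ⟨hitAfter_congr h hn, rfl⟩) hfin
  simp only [one_mul] at h
  calc ∫⁻ ω, ENNReal.ofReal (taxiNorm (ω (returnTime ω).toNat)) ∂(walkLaw α y)
      = ∫⁻ ω, ENNReal.ofReal (taxiNorm (shiftPath (rho ω).toNat ω
          (hit axis (shiftPath (rho ω).toNat ω)))) ∂(walkLaw α y) := by
        refine lintegral_congr_ae ?_
        filter_upwards [ae_isRegular hα y] with ω hω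
        rw [hω.returnTime_toNat, hω.rho_eq, ENat.toNat_natCast, shiftPath_apply]
    _ = _ := h
    _ ≤ ∫⁻ ω, ENNReal.ofReal (taxiNorm (ω (hit cone ω))) ∂(walkLaw α y) := by
        refine lintegral_mono_ae ?_
        filter_upwards [ae_isRegular hα y] with ω hω
        rw [hω.rho_eq, ENat.toNat_natCast]
        exact lintegral_taxiNorm_entrance_le α hω.hit_cone_spec.2.1
    _ ≤ 5 := lintegral_taxiNorm_exit_le hα hy

/-- By invariance the mean norm is also the mean norm after one step, which is at most `5` from
every starting point; no prior integrability is required. -/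
theorem tsum_taxiNorm_le (hα : 3 < α) (hp : ∑' y, p y = 1)
    (hinv : ∀ x, ∑' y, p y * returnProb α y x = p x) :
    ∑' x : axis, p x * ENNReal.ofReal (taxiNorm (x : ℤ × ℤ)) ≤ 5 := by
  calc ∑' x : axis, p x * ENNReal.ofReal (taxiNorm (x : ℤ × ℤ))
      = ∑' x : axis, ∑' y : axis, p y * (returnProb α y x *
          ENNReal.ofReal (taxiNorm (x : ℤ × ℤ))) := by
        refine tsum_congr fun x => ?_
        rw [← hinv x, ← ENNReal.tsum_mul_right]
        exact tsum_congr fun y => mul_assoc _ _ _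
    _ = ∑' y : axis, p y * ∑' x : axis, returnProb α y x *
          ENNReal.ofReal (taxiNorm (x : ℤ × ℤ)) := by
        rw [ENNReal.tsum_comm]
        simp only [ENNReal.tsum_mul_left]
    _ ≤ ∑' y : axis, p y * 5 := by
        refine ENNReal.tsum_le_tsum fun y => ?_
        gcongr
        rw [← lintegral_return hα y fun x => ENNReal.ofReal (taxiNorm x)]
        exact lintegral_taxiNorm_return_le hα y.2
    _ = 5 := by rw [ENNReal.tsum_mul_right, hp, one_mul]

theorem sojournBound_le {x : ℤ × ℤ} (hx : x ∈ axis) : sojournBound x ≤ 5 + 2 * taxiNorm x := by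
  by_cases h0 : maxNorm x = 0
  · rw [maxNorm_eq_zero_iff.1 h0, sojournBound_zero]
    simp [taxiNorm]
  · rw [sojournBound_axis hx h0, taxiNorm_eq_maxNorm hx]
    linarith

/-- The linear bound on the mean of `ρ` is integrated against the first moment of the invariant law.
-/
theorem tsum_meanRho_ne_top (hα : 3 < α) (hp : ∑' y, p y = 1)
    (hinv : ∀ x, ∑' y, p y * returnProb α y x = p x) :
    ∑' x : axis, p x * meanRho α x ≠ ⊤ := by
  have hle : ∑' x : axis, p x * meanRho α x ≤ 5 + 2 * 5 := by
    calc ∑' x : axis, p x * meanRho α x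
        ≤ ∑' x : axis, (p x * 5 + 2 * (p x * ENNReal.ofReal (taxiNorm (x : ℤ × ℤ)))) := by
          refine ENNReal.tsum_le_tsum fun x => ?_
          have ht : (0 : ℝ) ≤ taxiNorm (x : ℤ × ℤ) := by exact_mod_cast taxiNorm_nonneg _
          calc p x * meanRho α x ≤ p x * ENNReal.ofReal (5 + 2 * taxiNorm (x : ℤ × ℤ)) := by
                gcongr
                exact (meanRho_le hα x.2).trans
                  (ENNReal.ofReal_le_ofReal (sojournBound_le x.2))
            _ = p x * 5 + 2 * (p x * ENNReal.ofReal (taxiNorm (x : ℤ × ℤ))) := by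
                rw [ENNReal.ofReal_add (by norm_num) (by positivity),
                  ENNReal.ofReal_mul (by norm_num)]
                norm_num
                ring
      _ = 5 + 2 * ∑' x : axis, p x * ENNReal.ofReal (taxiNorm (x : ℤ × ℤ)) := by
          rw [ENNReal.tsum_add, ENNReal.tsum_mul_right, hp, one_mul, ENNReal.tsum_mul_left]
      _ ≤ 5 + 2 * 5 := by gcongr; exact tsum_taxiNorm_le hα hp hinv
  exact ne_top_of_le_ne_top (by finiteness) hle

theorem meanLocalTimeZero_le (hα : 3 < α) (x : ℤ × ℤ) : meanLocalTimeZero α x ≤ meanRho α x := by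
  rw [← lintegral_sojournVisits hα, ← lintegral_sojournTime hα]
  exact lintegral_mono fun ω => Nat.cast_le.2 (visits_le _ _ _)

end

end AxisWalk

theorem mainTheorem6 (α : ℝ≥0) (hα : 3 < α) :
    (∀ᵐ ω ∂(AxisWalk.walkLaw α (1, 1)), ∀ m, AxisWalk.rhoTime m ω ≠ ⊤) ∧
    ∃ π : PMF AxisWalk.axis,
      AxisWalk.IsInvariant α π ∧
      (∀ π' : PMF AxisWalk.axis, AxisWalk.IsInvariant α π' → π' = π) ∧
      (∑' x : AxisWalk.axis, π x * AxisWalk.meanRho α x) ≠ ⊤ ∧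
      (∑' x : AxisWalk.axis, π x * AxisWalk.meanLocalTimeZero α x) ≠ ⊤ ∧
      TendstoInMeasure (AxisWalk.walkLaw α (1, 1))
        (fun (m : ℕ) ω =>
          (1 / (m : ℝ)) * ((AxisWalk.localTime AxisWalk.axis (AxisWalk.rhoTime m ω) ω).toNat : ℝ))
        atTop
        (fun _ => (∑' x : AxisWalk.axis, π x * AxisWalk.meanRho α x).toReal) ∧
      TendstoInMeasure (AxisWalk.walkLaw α (1, 1))
        (fun (m : ℕ) ω =>
          (1 / (m : ℝ)) * ((AxisWalk.localTime {(0, 0)} (AxisWalk.rhoTime m ω) ω).toNat : ℝ))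
        atTop
        (fun _ => (∑' x : AxisWalk.axis, π x * AxisWalk.meanLocalTimeZero α x).toReal) := by
  set x₀ : AxisWalk.axis := ⟨(1, 0), AxisWalk.one_zero_mem_axis⟩
  set p := AxisWalk.doeblinLaw (AxisWalk.returnProb α) x₀ AxisWalk.doeblinConst with hpdef
  have hp : ∑' y, p y = 1 := AxisWalk.tsum_doeblinLaw (AxisWalk.tsum_returnProb hα)
    (AxisWalk.le_returnProb hα) AxisWalk.doeblinConst_ne_zero
  have hinv : ∀ x, ∑' y, p y * AxisWalk.returnProb α y x = p x :=
    AxisWalk.doeblinLaw_invariant (AxisWalk.tsum_returnProb hα) (AxisWalk.le_returnProb hα)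
      AxisWalk.doeblinConst_ne_zero
  have hdecomp : ∀ᵐ ω ∂(AxisWalk.walkLaw α (1, 1)), AxisWalk.IsRegular ω ∧ ω 0 ∈ AxisWalk.cone := by
    filter_upwards [AxisWalk.ae_isRegular hα (1, 1), AxisWalk.ae_start α (1, 1)] with ω h h0
    exact ⟨h, by rw [h0]; exact AxisWalk.one_one_mem_cone⟩
  have hmeanRho : ∑' x : AxisWalk.axis, p x * AxisWalk.meanRho α x =
      ∫⁻ ω, (AxisWalk.sojournTime ω : ℝ≥0∞) ∂(AxisWalk.mixedLaw α p) := by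
    rw [AxisWalk.lintegral_mixedLaw]
    simp only [AxisWalk.lintegral_sojournTime hα]
  have hmeanZero : ∑' x : AxisWalk.axis, p x * AxisWalk.meanLocalTimeZero α x =
      ∫⁻ ω, (AxisWalk.sojournVisits ω : ℝ≥0∞) ∂(AxisWalk.mixedLaw α p) := by
    rw [AxisWalk.lintegral_mixedLaw]
    simp only [AxisWalk.lintegral_sojournVisits hα]
  have hfinRho := AxisWalk.tsum_meanRho_ne_top hα hp hinv
  have hfinZero : ∑' x : AxisWalk.axis, p x * AxisWalk.meanLocalTimeZero α x ≠ ⊤ :=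
    ne_top_of_le_ne_top hfinRho (ENNReal.tsum_le_tsum fun x =>
      mul_le_mul_right (AxisWalk.meanLocalTimeZero_le hα x) _)
  refine ⟨?_, ⟨p, ENNReal.summable.hasSum_iff.2 hp⟩, hinv, ?_, hfinRho, hfinZero, ?_, ?_⟩
  · filter_upwards [hdecomp] with ω hω m
    obtain ⟨r, -, hr, -⟩ := hω.1.exists_rhoTime_eq hω.2 m
    rw [hr]
    exact ENat.natCast_ne_top r
  · intro π' hπ'
    refine PMF.ext fun x => congrFun ?_ x
    exact AxisWalk.eq_doeblinLaw (AxisWalk.tsum_returnProb hα) (AxisWalk.le_returnProb hα)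
      AxisWalk.doeblinConst_ne_zero π'.tsum_coe hπ'
  · change TendstoInMeasure _ _ _
      (fun _ => (∑' x : AxisWalk.axis, p x * AxisWalk.meanRho α x).toReal)
    rw [hmeanRho] at hfinRho ⊢
    refine AxisWalk.tendstoInMeasure_of_cycleSum hα hp hinv AxisWalk.measurable_sojournTime
      AxisWalk.isSojournFunctional_sojournTime hfinRho ?_
    filter_upwards [hdecomp] with ω hω m
    obtain ⟨r, -, hr, -, -, -, hva, -⟩ := hω.1.exists_rhoTime_eq hω.2 m
    rw [hr, AxisWalk.localTime_coe, ENat.toNat_natCast, hva]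
  · change TendstoInMeasure _ _ _
      (fun _ => (∑' x : AxisWalk.axis, p x * AxisWalk.meanLocalTimeZero α x).toReal)
    rw [hmeanZero] at hfinZero ⊢
    refine AxisWalk.tendstoInMeasure_of_cycleSum hα hp hinv AxisWalk.measurable_sojournVisits
      AxisWalk.isSojournFunctional_sojournVisits hfinZero ?_
    filter_upwards [hdecomp] with ω hω m
    obtain ⟨r, -, hr, -, -, -, -, hvz⟩ := hω.1.exists_rhoTime_eq hω.2 m
    rw [hr, AxisWalk.localTime_coe, ENat.toNat_natCast, hvz]
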